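/- All varieties are quasi-projective over $\mathbb{C}$, possibly singular and possibly reducible. Let $X$ be a variety all of whose irreducible components have dimension $n$. Let $\mathbf{K}_{rat}(X)$ be the collection of finite dimensional complex vector spaces $L$ of rational functions on $X$ whose restriction to every irreducible component of $X$ is non-zero. A closed subvariety $\Sigma\subset X$ is called admissible for $L_1,\dots,L_n\in\mathbf{K}_{rat}(X)$ if it contains the singular locus of $X$, has dimension $<n$, contains every irreducible divisor along which some function from some $L_i$ has a pole, and contains the base locus of every $L_i$ (the set of points where all functions in $L_i$ vanish). For a smooth open set $U \subset X$ and finite dimensional spaces $M_1,\dots,M_n$ of regular functions on $U$ without base locus on $U$, let $[M_1,\dots,M_n]_U$ be the maximum number of roots in $U$ of a system $f_1=\dots=f_n=0$ over all $(f_1,\dots,f_n)\in M_1\times\dots\times M_n$ for which the system has finitely many roots. (1) For all $L_1,\dots,L_n\in\mathbf{K}_{rat}(X)$ an admissible $\Sigma$ exists. For every admissible $\Sigma$ the functions from the $L_i$ are regular on $X\setminus\Sigma$, the restrictions of the $L_i$ are finite dimensional without base locus on $X \setminus \Sigma$, and the maximum defining $[L_1,\dots,L_n]_{X\setminus\Sigma}$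 is attained and does not depend on the choice of the admissible $\Sigma$. The common value is denoted by $[L_1,\dots,L_n]_X$. (2) Let $\tau: X\dashrightarrow Y$ be a birational isomorphism over $\mathbb{C}$ (an isomorphism between dense open subsets) of varieties all of whose irreducible components have dimension $n$. Then for all $L_1,\dots,L_n\in\mathbf{K}_{rat}(Y)$ the pull-backs $\tau^*L_i$ belong to $\mathbf{K}_{rat}(X)$ and $$[L_1,\dots,L_n]_Y=[\tau^*L_1,\dots,\tau^*L_n]_X .$$ -/

import Mathlib

open CategoryTheory AlgebraicGeometry TopologicalSpace

noncomputable section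

namespace RatIndex

/-- The base scheme `Spec ℂ`. -/
abbrev SpecC : Scheme.{0} := Spec (CommRingCat.of ℂ)

/-! ### Quasi-projective complex varieties -/

attribute [local instance] MvPolynomial.gradedAlgebra

/-- Complex projective space `ℙ^N`. -/
abbrev ProjC (N : ℕ) : Scheme.{0} :=
  Proj (MvPolynomial.homogeneousSubmodule (Fin (N + 1)) ℂ)

/-- The structure morphism `ℙ^N ⟶ Spec ℂ`. -/
def projCStr (N : ℕ) : ProjC N ⟶ SpecC :=
  Proj.toSpecZero (MvPolynomial.homogeneousSubmodule (Fin (N + 1)) ℂ) ≫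
    Spec.map (CommRingCat.ofHom
      (algebraMap ℂ (MvPolynomial.homogeneousSubmodule (Fin (N + 1)) ℂ 0)))

/-- Quasi-projective complex varieties: reduced schemes of finite type over `ℂ`, possibly
reducible and possibly singular, that are locally closed in some `ℙ^N`. -/
class IsQuasiProjVariety (X : Scheme.{0}) [X.Over SpecC] : Prop where
  isReduced : IsReduced X
  locallyOfFiniteType : LocallyOfFiniteType (X ↘ SpecC)
  quasiCompact : QuasiCompact (X ↘ SpecC)
  exists_immersion : ∃ (N : ℕ) (j : X ⟶ ProjC N), IsImmersion j ∧ j ≫ projCStr N = X ↘ SpecC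

/-- All irreducible components of `X` have dimension `n`. -/
def IsPureDim (X : Scheme.{0}) (n : ℕ) : Prop :=
  ∀ Z ∈ irreducibleComponents X, topologicalKrullDim Z = n

/-! ### Rational functions -/

section RatFun

variable (X : Scheme.{0})

/-- The ring of rational functions on a (possibly reducible) variety `X`: the product, over the
irreducible components of `X`, of the local rings at their generic points. As `X` is reduced,
these local rings are the function fields of the components. The restriction of `f` to the
component with generic point `x` is `f x`. -/
def RatFun : Type := ∀ x : genericPoints X, X.presheaf.stalk x.1

instance : CommRing (RatFun X) :=
  inferInstanceAs (CommRing (∀ x : genericPoints X, X.presheaf.stalk x.1))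

variable {X}

/-- The inclusion of the constants `ℂ` in the regular functions on the open set `U`. -/
def constHom [X.Over SpecC] (U : X.Opens) : ℂ →+* Γ(X, U) :=
  ((Scheme.ΓSpecIso (CommRingCat.of ℂ)).inv ≫ (X ↘ SpecC).appLE ⊤ U le_top).hom

instance [X.Over SpecC] (U : X.Opens) : Algebra ℂ Γ(X, U) := (constHom U).toAlgebra

instance [X.Over SpecC] : Algebra ℂ (RatFun X) :=
  RingHom.toAlgebra (RingHom.pi fun x : genericPoints X =>
    (X.presheaf.germ ⊤ x.1 (Opens.mem_top _)).hom.comp (constHom ⊤))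

/-- The regular function `s` on `U` represents the rational function `f`. -/
def Represents {U : X.Opens} (s : Γ(X, U)) (f : RatFun X) : Prop :=
  ∀ (x : genericPoints X) (hx : x.1 ∈ U), X.presheaf.germ U x.1 hx s = f x

/-- `f` is regular at `x`. -/
def IsRegularAt (f : RatFun X) (x : X) : Prop :=
  ∃ (U : X.Opens) (_ : x ∈ U) (s : Γ(X, U)), Represents s f

/-- `f` is regular at `x` and vanishes there. -/
def VanishesAt (f : RatFun X) (x : X) : Prop :=
  ∃ (U : X.Opens) (_ : x ∈ U) (s : Γ(X, U)), Represents s f ∧ x ∉ X.basicOpen s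

/-- `f` has a pole along the irreducible divisor `D`: `D` is an irreducible closed subset of
codimension one, and `f` is not in the local ring of `X` along `D`. -/
def HasPoleAlong (f : RatFun X) (D : Set X) : Prop :=
  IsIrreducible D ∧ IsClosed D ∧ ∃ z : X, IsGenericPoint z D ∧
    ringKrullDim (X.presheaf.stalk z) = 1 ∧ ¬ IsRegularAt f z

end RatFun

/-! ### The intersection index -/

section Index

variable {X : Scheme.{0}} [X.Over SpecC]

/-- The collection `K_rat(X)`: finite dimensional spaces of rational functions whose restriction
to every irreducible component is non-zero. -/
def Krat (X : Scheme.{0}) [X.Over SpecC] : Set (Submodule ℂ (RatFun X)) :=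
  {L | FiniteDimensional ℂ L ∧ ∀ x : genericPoints X, ∃ f ∈ L, f x ≠ 0}

/-- The collection `K_reg(U)`: finite dimensional spaces of regular functions on `U` without
base locus on `U`. -/
def Kreg (U : X.Opens) : Set (Submodule ℂ Γ(X, U)) :=
  {M | FiniteDimensional ℂ M ∧ ∀ x ∈ U, ∃ s ∈ M, x ∈ X.basicOpen s}

/-- The points of `U` where the system `s₁ = ⋯ = sₙ = 0` holds (points in the classical sense,
that is, closed points). -/
def roots {n : ℕ} (U : X.Opens) (s : Fin n → Γ(X, U)) : Set X :=
  {x | x ∈ U ∧ IsClosed ({x} : Set X) ∧ ∀ i, x ∉ X.basicOpen (s i)}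

/-- The numbers of roots in `U` of the systems `s₁ = ⋯ = sₙ = 0`, `sᵢ ∈ Mᵢ`, that have only
finitely many roots. -/
def rootCounts {n : ℕ} (U : X.Opens) (M : Fin n → Submodule ℂ Γ(X, U)) : Set ℕ :=
  {k | ∃ s : Fin n → Γ(X, U), (∀ i, s i ∈ M i) ∧ (roots U s).Finite ∧ (roots U s).ncard = k}

/-- The intersection index `[M₁, …, Mₙ]_U` of spaces of regular functions on `U`: the maximum
of `rootCounts`. -/
def regIndex {n : ℕ} (U : X.Opens) (M : Fin n → Submodule ℂ Γ(X, U)) : ℕ :=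
  sSup (rootCounts U M)

/-- `X` is smooth over `ℂ` near `x`. -/
def IsSmoothPoint (x : X) : Prop :=
  ∃ U : X.Opens, x ∈ U ∧ Smooth (U.ι ≫ X ↘ SpecC)

/-- The set `S` is an admissible subvariety of the `n`-dimensional variety `X` for
`L₁, …, Lₙ`. -/
structure IsAdmissible {n : ℕ} (L : Fin n → Submodule ℂ (RatFun X)) (S : Closeds X) : Prop where
  singular : ∀ x : X, ¬ IsSmoothPoint x → x ∈ S
  dim_lt : topologicalKrullDim (S : Set X) < n
  poles : ∀ i, ∀ f ∈ L i, ∀ D : Set X, HasPoleAlong f D → D ⊆ S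
  baseLocus : ∀ i, ∀ x : X, (∀ f ∈ L i, VanishesAt f x) → x ∈ S

lemma algebraMap_section (U : X.Opens) (c : ℂ) : algebraMap ℂ Γ(X, U) c = constHom U c := rfl

lemma germ_constHom {U V : X.Opens} (x : X) (hU : x ∈ U) (hV : x ∈ V) (c : ℂ) :
    X.presheaf.germ U x hU (constHom U c) = X.presheaf.germ V x hV (constHom V c) := by
  have key : ∀ (W : X.Opens) (hW : x ∈ W), X.presheaf.germ W x hW (constHom W c) =
      X.presheaf.germ ⊤ x (Opens.mem_top _) (constHom ⊤ c) := by
    intro W hW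
    have h : constHom W c = X.presheaf.map (homOfLE le_top).op (constHom (⊤ : X.Opens) c) := by
      have := (X ↘ SpecC).appLE_map (U := ⊤) (V := ⊤) (V' := W) le_top (homOfLE le_top).op
      simp only [constHom, ← this]
      rfl
    rw [h]
    exact TopCat.Presheaf.germ_res_apply _ _ _ _ _
  rw [key U hU, key V hV]

lemma algebraMap_ratFun (c : ℂ) (x : genericPoints X) {U : X.Opens} (hU : x.1 ∈ U) :
    (algebraMap ℂ (RatFun X) c) x = X.presheaf.germ U x.1 hU (constHom U c) :=
  germ_constHom x.1 (U := ⊤) (Opens.mem_top _) hU c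

/-- The restriction of a space of rational functions to an open set `U`: the regular functions
on `U` that represent elements of `L`. -/
def restrict (L : Submodule ℂ (RatFun X)) (U : X.Opens) : Submodule ℂ Γ(X, U) where
  carrier := {s | ∃ f ∈ L, Represents s f}
  add_mem' := by
    rintro s t ⟨f, hf, hs⟩ ⟨g, hg, ht⟩
    refine ⟨f + g, L.add_mem hf hg, fun x hx => ?_⟩
    rw [map_add, hs x hx, ht x hx]
    rfl
  zero_mem' := ⟨0, L.zero_mem, fun x hx => by rw [map_zero]; rfl⟩
  smul_mem' := by
    rintro c s ⟨f, hf, hs⟩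
    refine ⟨c • f, L.smul_mem c hf, fun x hx => ?_⟩
    rw [Algebra.smul_def, Algebra.smul_def, map_mul, hs x hx, algebraMap_section,
      ← algebraMap_ratFun c x hx]
    rfl

/-- The index `[L₁, …, Lₙ]` on the complement of `S`. -/
def indexOff {n : ℕ} (L : Fin n → Submodule ℂ (RatFun X)) (S : Closeds X) : ℕ :=
  regIndex S.compl fun i => restrict (L i) S.compl

open Classical in
/-- The birationally invariant intersection index `[L₁, …, Lₙ]_X`, computed on the complement
of a chosen admissible subvariety. -/
def interIndex {n : ℕ} (L : Fin n → Submodule ℂ (RatFun X)) : ℕ :=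
  if h : ∃ S, IsAdmissible L S then indexOff L h.choose else 0

end Index

/-! ### Pull-back along a birational isomorphism -/

section Pullback

/-- Generic points of irreducible components are the points without proper generizations. -/
lemma mem_genericPoints_iff {X : Scheme.{0}} {x : X} :
    x ∈ genericPoints X ↔ ∀ y : X, y ⤳ x → x ⤳ y := by
  constructor
  · intro h y hy
    have h1 : closure {x} ⊆ closure {y} := specializes_iff_closure_subset.mp hy
    have h2 : closure {y} ⊆ closure {x} := h.2 isIrreducible_singleton.closure h1
    exact specializes_iff_closure_subset.mpr h2
  · intro h
    obtain ⟨Z, hZ, hxZ⟩ := exists_mem_irreducibleComponents_subset_of_isIrreducible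
      (closure {x}) isIrreducible_singleton.closure
    obtain ⟨y, hy⟩ := QuasiSober.sober hZ.1 (isClosed_of_mem_irreducibleComponents Z hZ)
    have hyx : y ⤳ x := hy.specializes (hxZ (subset_closure rfl))
    have : closure {x} = Z := by
      refine hxZ.antisymm ?_
      rw [← hy.def]
      exact specializes_iff_closure_subset.mp (h y hyx)
    exact (this ▸ hZ : closure {x} ∈ irreducibleComponents X)

lemma map_mem_genericPoints_iff {X Y : Scheme.{0}} (f : X ⟶ Y) [IsOpenImmersion f] (x : X) :
    f x ∈ genericPoints Y ↔ x ∈ genericPoints X := by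
  rw [mem_genericPoints_iff, mem_genericPoints_iff]
  have hind := f.isOpenEmbedding.isInducing
  constructor
  · intro h y hy
    exact hind.specializes_iff.mp (h _ (hind.specializes_iff.mpr hy))
  · intro h y hy
    obtain ⟨z, rfl⟩ := hy.mem_open f.isOpenEmbedding.isOpen_range ⟨x, rfl⟩
    exact hind.specializes_iff.mpr (h z (hind.specializes_iff.mp hy))

lemma genericPoint_mem_of_dense {X : Scheme.{0}} [X.Over SpecC] [hX : IsQuasiProjVariety X]
    {U : X.Opens} (hU : Dense (U : Set X)) (x : genericPoints X) : x.1 ∈ U := by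
  have := hX.locallyOfFiniteType
  have := hX.quasiCompact
  have : CompactSpace X := by
    exact QuasiCompact.compactSpace_of_compactSpace (X ↘ SpecC)
  have : IsLocallyNoetherian X := LocallyOfFiniteType.isLocallyNoetherian (X ↘ SpecC)
  have : IsNoetherian X := {}
  have hfin := NoetherianSpace.finite_irreducibleComponents (α := X)
  let C : Set X := ⋃₀ (irreducibleComponents X \ {closure {x.1}})
  have hC : IsClosed C := by
    rw [show C = ⋃ Z ∈ irreducibleComponents X \ {closure {x.1}}, Z from Set.sUnion_eq_biUnion]
    exact (hfin.subset Set.sdiff_subset).isClosed_biUnion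
      fun Z hZ => isClosed_of_mem_irreducibleComponents Z hZ.1
  have hxC : x.1 ∉ C := by
    rintro ⟨Z, ⟨hZ, hne⟩, hxZ⟩
    have hsub : closure {x.1} ⊆ Z :=
      closure_minimal (by simpa using hxZ) (isClosed_of_mem_irreducibleComponents Z hZ)
    exact hne (hsub.antisymm (x.2.2 hZ.1 hsub)).symm
  obtain ⟨u, huC, huU⟩ := hU.inter_open_nonempty Cᶜ hC.isOpen_compl ⟨x.1, hxC⟩
  have hu : u ∈ closure {x.1} := by
    by_contra hne
    exact huC ⟨irreducibleComponent u, ⟨irreducibleComponent_mem_irreducibleComponents u,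
      fun h => hne (h ▸ mem_irreducibleComponent)⟩, mem_irreducibleComponent⟩
  exact (specializes_iff_mem_closure.mpr hu).mem_open U.isOpen huU

variable {X Y : Scheme.{0}} [X.Over SpecC] [Y.Over SpecC] [IsQuasiProjVariety X]

/-- The morphism from the domain of the birational isomorphism `τ` to `Y`. -/
def toHom (τ : X.PartialIso Y) : τ.source.toScheme ⟶ Y := τ.iso.hom ≫ τ.target.ι

instance (τ : X.PartialIso Y) : IsOpenImmersion (toHom τ) := by
  unfold toHom; infer_instance

/-- A generic point of `X` as a point of the domain of `τ`. -/
def srcPt (τ : X.PartialIso Y) (x : genericPoints X) : τ.source.toScheme :=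
  ⟨x.1, genericPoint_mem_of_dense τ.dense_source x⟩

/-- The generic point of `Y` to which `τ` sends a generic point of `X`. -/
def mapGeneric (τ : X.PartialIso Y) (x : genericPoints X) : genericPoints Y :=
  ⟨toHom τ (srcPt τ x), (map_mem_genericPoints_iff _ _).mpr
    ((map_mem_genericPoints_iff τ.source.ι (srcPt τ x)).mp x.2)⟩

/-- The local homomorphism induced by `τ` at a generic point of `X`. -/
def stalkPullback (τ : X.PartialIso Y) (x : genericPoints X) :
    Y.presheaf.stalk (mapGeneric τ x).1 →+* X.presheaf.stalk x.1 :=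
  ((toHom τ).stalkMap (srcPt τ x) ≫ inv (τ.source.ι.stalkMap (srcPt τ x))).hom

lemma stalkMap_const {U X : Scheme.{0}} [X.Over SpecC] (f : U ⟶ X) (p : U) (c : ℂ) :
    f.stalkMap p (X.presheaf.germ ⊤ (f p) (Opens.mem_top _) (constHom ⊤ c)) =
      U.presheaf.germ ⊤ p (Opens.mem_top _) ((f ≫ X ↘ SpecC).appTop
        ((Scheme.ΓSpecIso (CommRingCat.of ℂ)).inv c)) := by
  have h : (constHom (⊤ : X.Opens) c) =
      (X ↘ SpecC).appTop ((Scheme.ΓSpecIso (CommRingCat.of ℂ)).inv c) := by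
    simp only [constHom, Scheme.Hom.appLE]
    simp
    rfl
  rw [h]
  exact (Scheme.Hom.germ_stalkMap_apply f ⊤ p _ _).trans (by rw [Scheme.Hom.comp_appTop]; rfl)

/-- The pull-back `τ^* : ℂ(Y) → ℂ(X)` of rational functions along a birational isomorphism. -/
def ratPullback (τ : X.PartialIso Y) (hτ : τ.IsOver (X ↘ SpecC) (Y ↘ SpecC)) :
    RatFun Y →ₐ[ℂ] RatFun X where
  __ := RingHom.pi fun x : genericPoints X =>
    (stalkPullback τ x).comp
      (Pi.evalRingHom (fun y : genericPoints Y => Y.presheaf.stalk y.1) (mapGeneric τ x))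
  commutes' := by
    intro c
    funext x
    change inv (τ.source.ι.stalkMap (srcPt τ x)) ((toHom τ).stalkMap (srcPt τ x)
      (Y.presheaf.germ ⊤ (toHom τ (srcPt τ x)) (Opens.mem_top _) (constHom ⊤ c))) =
      X.presheaf.germ ⊤ (τ.source.ι (srcPt τ x)) (Opens.mem_top _) (constHom ⊤ c)
    have h : toHom τ ≫ Y ↘ SpecC = τ.source.ι ≫ X ↘ SpecC := by
      rw [toHom, Category.assoc]; exact hτ
    rw [stalkMap_const, h, ← stalkMap_const τ.source.ι]
    exact ConcreteCategory.congr_hom (IsIso.hom_inv_id (τ.source.ι.stalkMap (srcPt τ x))) _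

end Pullback

end RatIndex

end

open RatIndex

/-!
The index does not depend on the admissible set, nor on the birational model, because the maximal
number of zeros is attained by a *generic* system, and a generic system has that many zeros already
in any prescribed dense open subset. Smoothness plays no role in this; it is only
needed to see that on the complement of an admissible set all functions of the `Lᵢ` are regular.

Call a dense open set `U` good (`IsGood`) if the functions of all `Lᵢ` are regular on `U` and no
`Lᵢ` has a base point in `U`. Choose generators `g i j` of `Lᵢ` and consider the systems `f_c` with
`(f_c)ᵢ = ∑ j, c (i, j) • g i j`. Two facts about a good set `U` carry the proof:

* the number of zeros of `f_c` in `U` is bounded for generic `c` (`IsGood.exists_bound_zeros`);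
* if `f_{c₀}` has finitely many zeros in `U`, then for every dense open `V` a generic `f_c` has at
  least as many zeros in `V` (`IsGood.generic_encard_zeros_le`).

Hence the maximum over the systems with finitely many zeros exists, and it is the same for `U` and
for every dense open subset of `U` (`IsGood.exists_isGreatest`). Two good sets are compared through
their intersection, and a birational isomorphism identifies a good set of `Y` with one of `X`.

Both facts are local: finitely many points of a quasi-projective variety lie in an affine open set
(`exists_isAffineOpen_of_finite`), which may be taken so small that every `Lᵢ` contains an invertible
function on it. Dividing by that function, the system acquires constant terms, and these can be
solved for: the incidence variety of the system and its parameters is then an affine space over the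
affine variety. On each irreducible component it has the dimension of the parameter space, so the
claims become statements about the fibres of a morphism `Spec A → 𝔸^σ` with `A` a domain of
transcendence degree `|σ|`. The generic fibre is bounded since `A` is algebraic over the polynomial
ring (`exists_bound_pointsOver`). A finite fibre has no more points than a generic one
(`generic_encard_pointsOver_le`): by Zariski's main theorem some `θ` integral over the polynomial
ring separates the points of the fibre, so its minimal polynomial has at least as many roots as the
fibre has points; the polynomial ring being normal, that polynomial specializes to one with only
simple roots for generic parameters, and each root comes from a point of the fibre.

The complement of an admissible set is good (`IsAdmissible.isGood`). A smooth variety is locally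
étale over an affine space, hence normal (`isIntegrallyClosed_of_etale`), and on a normal variety a
rational function that is not regular at a point has a pole along a divisor through that point
(`exists_height_eq_one_of_forall_dvd`). Admissible sets exist (`exists_isAdmissible`) since the
smooth locus is dense over a perfect field.
-/

open RatIndex

namespace RatIndex

/-! ### Generic parameters -/

/-- A property of a tuple of complex parameters holds generically if it holds off the zero locus
of some non-zero polynomial. -/
def Generic {κ : Type} (P : (κ → ℂ) → Prop) : Prop :=
  ∃ F : MvPolynomial κ ℂ, F ≠ 0 ∧ ∀ c, MvPolynomial.eval c F ≠ 0 → P c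

namespace Generic

variable {κ : Type} {P Q : (κ → ℂ) → Prop}

lemma mono (h : Generic P) (hPQ : ∀ c, P c → Q c) : Generic Q :=
  let ⟨F, hF, hP⟩ := h
  ⟨F, hF, fun c hc => hPQ c (hP c hc)⟩

lemma of_forall (h : ∀ c, P c) : Generic P :=
  ⟨1, one_ne_zero, fun c _ => h c⟩

lemma and (hP : Generic P) (hQ : Generic Q) : Generic fun c => P c ∧ Q c := by
  obtain ⟨F, hF, hP⟩ := hP
  obtain ⟨G, hG, hQ⟩ := hQ
  refine ⟨F * G, mul_ne_zero hF hG, fun c hc => ?_⟩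
  rw [map_mul] at hc
  exact ⟨hP c (left_ne_zero_of_mul hc), hQ c (right_ne_zero_of_mul hc)⟩

lemma finset_forall {α : Type*} (s : Finset α) {P : α → (κ → ℂ) → Prop}
    (h : ∀ a ∈ s, Generic (P a)) : Generic fun c => ∀ a ∈ s, P a c := by
  classical
  induction s using Finset.induction_on with
  | empty => exact of_forall fun c a ha => by simp at ha
  | insert a s ha ih =>
    refine ((h a (Finset.mem_insert_self a s)).and
      (ih fun b hb => h b (Finset.mem_insert_of_mem hb))).mono fun c hc b hb => ?_
    rcases Finset.mem_insert.mp hb with rfl | hb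
    exacts [hc.1, hc.2 b hb]

lemma nonempty (h : Generic P) : ∃ c, P c := by
  obtain ⟨F, hF, hP⟩ := h
  by_contra! hne
  exact hF (MvPolynomial.funext fun c => by
    by_contra hc
    exact hne c (hP c (by simpa using hc)))

end Generic

/-! ### Complex points of finite type algebras -/

section Fibres

open MvPolynomial Polynomial

variable {A : Type} [CommRing A] [Algebra ℂ A] {σ : Type}

/-- The complex points of `Spec A` at which the functions `x i` take the values `c i`. -/
def pointsOver (x : σ → A) (c : σ → ℂ) : Set (A →ₐ[ℂ] ℂ) :=
  {ψ | ∀ i, ψ (x i) = c i}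

lemma pointsOver_aeval {x : σ → A} {c : σ → ℂ} {ψ : A →ₐ[ℂ] ℂ} (hψ : ψ ∈ pointsOver x c)
    (F : MvPolynomial σ ℂ) : ψ (MvPolynomial.aeval x F) = MvPolynomial.eval c F := by
  have : ψ.comp (MvPolynomial.aeval x) = MvPolynomial.aeval c :=
    MvPolynomial.algHom_ext fun i => by simpa using hψ i
  rw [← AlgHom.comp_apply, this]
  rfl

/-- Every element is a root of a non-zero polynomial whose coefficients are polynomials in the
members of a transcendence basis. -/
lemma isAlgebraic_of_isTranscendenceBasis {x : σ → A} (hx : IsTranscendenceBasis ℂ x) (b : A) :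
    ∃ P : (MvPolynomial σ ℂ)[X], P ≠ 0 ∧
      Polynomial.eval₂ (MvPolynomial.aeval (R := ℂ) x).toRingHom b P = 0 := by
  have h1 := hx.isAlgebraic
  obtain ⟨p, hp, hpb⟩ := h1.isAlgebraic b
  let e := hx.1.aevalEquiv
  refine ⟨p.map e.symm.toRingEquiv.toRingHom, ?_, ?_⟩
  · rwa [Ne, Polynomial.map_eq_zero_iff e.symm.injective]
  · rw [Polynomial.eval₂_map]
    rw [Polynomial.aeval_def] at hpb
    have he : (MvPolynomial.aeval x).toRingHom.comp e.symm.toRingEquiv.toRingHom =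
        algebraMap (Algebra.adjoin ℂ (Set.range x)) A :=
      RingHom.ext fun y => by
        obtain ⟨y, rfl⟩ := e.surjective y
        change MvPolynomial.aeval x (e.symm (e y)) = _
        rw [e.symm_apply_apply]
        exact (hx.1.algebraMap_aevalEquiv y).symm
    rwa [he]

/-- The fibres of `Spec A → 𝔸^σ` over generic points have a bounded number of points: the values of
the generators of `A` are roots of the specializations of fixed polynomials. -/
lemma exists_bound_pointsOver [IsDomain A] [Algebra.FiniteType ℂ A] [Finite σ] (x : σ → A)
    (h : Algebra.trdeg ℂ A ≤ Cardinal.mk σ) :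
    ∃ D : ℕ, Generic fun c => (pointsOver x c).encard ≤ D := by
  classical
  by_cases hx : AlgebraicIndependent ℂ x
  · have hb := hx.isTranscendenceBasis_of_trdeg_le_of_finite h
    -- A point is determined by its values at finitely many generators.
    obtain ⟨s, hs⟩ := Algebra.FiniteType.out (R := ℂ) (A := A)
    choose P hP hPb using isAlgebraic_of_isTranscendenceBasis hb
    let roots (c : σ → ℂ) (b : A) : Finset ℂ := ((P b).map (MvPolynomial.eval c)).roots.toFinset
    refine ⟨∏ b : s, (P b).natDegree, ∏ b : s, (P b).leadingCoeff,
      Finset.prod_ne_zero_iff.mpr fun b _ => Polynomial.leadingCoeff_ne_zero.mpr (hP b),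
      fun c hc => ?_⟩
    rw [map_prod, Finset.prod_ne_zero_iff] at hc
    have hne : ∀ b : s, (P b).map (MvPolynomial.eval c) ≠ 0 := fun b h0 => hc b (Finset.mem_univ _)
      (by rw [Polynomial.leadingCoeff, ← Polynomial.coeff_map, h0, Polynomial.coeff_zero])
    let f : (A →ₐ[ℂ] ℂ) → (s → ℂ) := fun ψ b => ψ b
    have hf : Function.Injective f := fun ψ ψ' hψ =>
      AlgHom.ext_of_adjoin_eq_top hs fun b hb => congrFun hψ ⟨b, hb⟩
    have himage : f '' pointsOver x c ⊆ Fintype.piFinset fun b : s => roots c b := by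
      rintro _ ⟨ψ, hψ, rfl⟩
      refine Finset.mem_coe.mpr (Fintype.mem_piFinset.mpr fun b => ?_)
      rw [Multiset.mem_toFinset, Polynomial.mem_roots (hne b), Polynomial.IsRoot,
        Polynomial.eval_map]
      have := congrArg ψ (hPb b)
      rw [map_zero, ← AlgHom.coe_toRingHom, Polynomial.hom_eval₂] at this
      have he : (ψ : A →+* ℂ).comp (MvPolynomial.aeval (R := ℂ) x).toRingHom =
          MvPolynomial.eval c := RingHom.ext fun F => pointsOver_aeval hψ F
      rwa [he] at this
    rw [← hf.encard_image]
    refine (Set.encard_le_encard himage).trans ?_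
    rw [Set.encard_coe_eq_coe_finsetCard, Fintype.card_piFinset]
    refine Nat.cast_le.mpr (Finset.prod_le_prod' fun b _ => ?_)
    exact (Multiset.toFinset_card_le _).trans
      ((Polynomial.card_roots' _).trans Polynomial.natDegree_map_le)
  · -- A polynomial relation between the functions `x i` makes generic fibres empty.
    rw [algebraicIndependent_iff] at hx
    push Not at hx
    obtain ⟨F, hF, hF0⟩ := hx
    refine ⟨0, F, hF0, fun c hc => ?_⟩
    have : pointsOver x c = ∅ := Set.eq_empty_of_forall_notMem fun ψ hψ => hc
      (by rw [← pointsOver_aeval hψ, hF, map_zero])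
    simp [this]

end Fibres

/-! ### Finite fibres over affine space -/

section Nullstellensatz

open MvPolynomial Polynomial

/-- A quotient of a complex algebra by a maximal ideal, if integral over `ℂ`, is `ℂ`. -/
lemma exists_algHom_ker_eq_of_isIntegral {A : Type} [CommRing A] [Algebra ℂ A] (M : Ideal A)
    [M.IsMaximal] (h : Algebra.IsIntegral ℂ (A ⧸ M)) :
    ∃ ψ : A →ₐ[ℂ] ℂ, RingHom.ker ψ = M := by
  let := Ideal.Quotient.field M
  have hb : Function.Bijective (Algebra.ofId ℂ (A ⧸ M)) :=
    IsAlgClosed.algebraMap_bijective_of_isIntegral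
  let e := AlgEquiv.ofBijective (Algebra.ofId ℂ (A ⧸ M)) hb
  refine ⟨e.symm.toAlgHom.comp (Ideal.Quotient.mkₐ ℂ M), ?_⟩
  ext a
  change e.symm (Ideal.Quotient.mk M a) = 0 ↔ _
  rw [EmbeddingLike.map_eq_zero_iff, Ideal.Quotient.eq_zero_iff_mem]

/-- **Nullstellensatz**: the maximal ideals of a finite type complex algebra are the kernels of
its complex points. -/
lemma exists_algHom_ker_eq {A : Type} [CommRing A] [Algebra ℂ A] [Algebra.FiniteType ℂ A]
    (M : Ideal A) [M.IsMaximal] : ∃ ψ : A →ₐ[ℂ] ℂ, RingHom.ker ψ = M := by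
  let := Ideal.Quotient.field M
  have : Algebra.FiniteType ℂ (A ⧸ M) := inferInstance
  have : Module.Finite ℂ (A ⧸ M) := finite_of_finite_type_of_isJacobsonRing ℂ (A ⧸ M)
  exact exists_algHom_ker_eq_of_isIntegral M inferInstance

lemma algHom_ext_of_ker_le {A : Type} [CommRing A] [Algebra ℂ A] {φ ψ : A →ₐ[ℂ] ℂ}
    (h : RingHom.ker φ ≤ RingHom.ker ψ) : φ = ψ := by
  ext a
  have : a - algebraMap ℂ A (φ a) ∈ RingHom.ker φ := by simp [RingHom.mem_ker]
  have := h this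
  simp only [RingHom.mem_ker, map_sub, AlgHom.commutes, sub_eq_zero] at this
  exact this.symm

lemma ker_algHom_isMaximal {A : Type} [CommRing A] [Algebra ℂ A] (φ : A →ₐ[ℂ] ℂ) :
    (RingHom.ker φ).IsMaximal :=
  RingHom.ker_isMaximal_of_surjective φ fun c => ⟨algebraMap ℂ A c, φ.commutes c⟩

/-- Complex points lift along injective integral extensions. -/
lemma exists_algHom_extension {C D : Type} [CommRing C] [CommRing D] [Algebra ℂ C] [Algebra ℂ D]
    [Algebra C D] [IsScalarTower ℂ C D] [Algebra.IsIntegral C D]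
    (hinj : Function.Injective (algebraMap C D)) (χ : C →ₐ[ℂ] ℂ) :
    ∃ χ' : D →ₐ[ℂ] ℂ, ∀ c, χ' (algebraMap C D c) = χ c := by
  have hmax := ker_algHom_isMaximal χ
  obtain ⟨Q, hQ, hQP⟩ := Ideal.exists_ideal_over_maximal_of_isIntegral (S := D) (RingHom.ker χ)
    (by rw [(RingHom.injective_iff_ker_eq_bot _).mp hinj]; exact bot_le)
  have hc : ∀ c : C, Ideal.Quotient.mk Q (algebraMap C D c) = algebraMap ℂ (D ⧸ Q) (χ c) := by
    intro c
    have : c - algebraMap ℂ C (χ c) ∈ Q.comap (algebraMap C D) := by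
      rw [hQP]; simp [RingHom.mem_ker]
    rw [Ideal.mem_comap, map_sub, ← IsScalarTower.algebraMap_apply, ← Ideal.Quotient.eq] at this
    exact this
  obtain ⟨χ', hχ'⟩ := exists_algHom_ker_eq_of_isIntegral Q ⟨fun d => by
    obtain ⟨d, rfl⟩ := Ideal.Quotient.mk_surjective d
    obtain ⟨p, hp, hpd⟩ := Algebra.IsIntegral.isIntegral (R := C) d
    refine ⟨p.map (χ : C →+* ℂ), hp.map _, ?_⟩
    rw [Polynomial.eval₂_map]
    have := congrArg (Ideal.Quotient.mk Q) hpd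
    rw [Polynomial.hom_eval₂, map_zero] at this
    have he : (algebraMap ℂ (D ⧸ Q)).comp (χ : C →+* ℂ) =
        (Ideal.Quotient.mk Q).comp (algebraMap C D) := RingHom.ext fun c => (hc c).symm
    rwa [he]⟩
  refine ⟨χ', fun c => ?_⟩
  have : algebraMap C D c - algebraMap ℂ D (χ c) ∈ RingHom.ker χ' := by
    rw [hχ', ← Ideal.Quotient.eq]; exact hc c
  simpa [RingHom.mem_ker, sub_eq_zero] using this

/-- Generically, the specialization of a monic polynomial that is separable over the field of
rational functions has as many roots as its degree. -/
lemma generic_card_roots {σ : Type} (P : (MvPolynomial σ ℂ)[X]) (hP : P.Monic)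
    (hsep : (P.map (algebraMap (MvPolynomial σ ℂ)
      (FractionRing (MvPolynomial σ ℂ)))).Separable) :
    Generic fun c => (P.map (MvPolynomial.eval c)).roots.toFinset.card = P.natDegree := by
  set K := FractionRing (MvPolynomial σ ℂ)
  -- The resultant with the derivative detects separability, and is compatible with specialization.
  have hres {k : Type} [Field k] (f : MvPolynomial σ ℂ →+* k) [CharZero k] :
      f (resultant P (derivative P)) = resultant (P.map f) (derivative (P.map f)) := by
    rw [← resultant_map_map, natDegree_derivative, derivative_map, ← derivative_map,
      natDegree_derivative, hP.natDegree_map, derivative_map]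
  refine ⟨resultant P (derivative P), fun h0 => ?_, fun c hc => ?_⟩
  · have := hres (algebraMap (MvPolynomial σ ℂ) K)
    rw [h0, map_zero] at this
    exact (resultant_eq_zero_iff.mp this.symm).2 hsep
  · rw [hres, Ne, resultant_eq_zero_iff, not_and_not_right] at hc
    have hs : (P.map (MvPolynomial.eval c)).Separable := hc (Or.inl (hP.map _).ne_zero)
    rw [Multiset.toFinset_card_of_nodup (Polynomial.nodup_roots hs),
      IsAlgClosed.card_roots_eq_natDegree, hP.natDegree_map]

/-- A function on which all points of a finite fibre of `Spec A → 𝔸^σ` differ, and which is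
integral over the polynomial ring; in addition, by Zariski's main theorem, all of `A` is algebraic
over the polynomial ring. -/
lemma exists_isIntegral_injOn {A : Type} [CommRing A] [Algebra ℂ A] [Algebra.FiniteType ℂ A]
    [IsDomain A] {σ : Type} [Finite σ] (x : σ → A) (c : σ → ℂ) (hfin : (pointsOver x c).Finite)
    (hne : (pointsOver x c).Nonempty) :
    Algebra.IsAlgebraic (Algebra.adjoin ℂ (Set.range x)) A ∧
      ∃ θ : A, (MvPolynomial.aeval (R := ℂ) x).toRingHom.IsIntegralElem θ ∧
        Set.InjOn (fun ψ : A →ₐ[ℂ] ℂ => ψ θ) (pointsOver x c) := by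
  let R := MvPolynomial σ ℂ
  let : Algebra R A := (MvPolynomial.aeval (R := ℂ) x).toAlgebra
  have : IsScalarTower ℂ R A := .of_algebraMap_eq fun r => ((MvPolynomial.aeval x).commutes r).symm
  have : Algebra.FiniteType R A := .of_restrictScalars_finiteType ℂ R A
  have : IsJacobsonRing A := isJacobsonRing_of_finiteType (A := ℂ)
  have hmap : ∀ {ψ}, ψ ∈ pointsOver x c → ∀ F : R, ψ (algebraMap R A F) = MvPolynomial.eval c F :=
    fun hψ F => pointsOver_aeval hψ F
  have hcomap : ∀ {ψ}, ψ ∈ pointsOver x c →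
      (RingHom.ker ψ).comap (algebraMap R A) = RingHom.ker (MvPolynomial.eval c) := by
    intro ψ hψ
    ext F
    rw [Ideal.mem_comap, RingHom.mem_ker, RingHom.mem_ker, hmap hψ]
  -- The fibre is discrete since it is a Jacobson space with finitely many closed points.
  have hZ : ∀ ψ ∈ pointsOver x c, Algebra.ZariskisMainProperty R (RingHom.ker ψ) := by
    intro ψ hψ
    have hmax := ker_algHom_isMaximal ψ
    let q : PrimeSpectrum A := ⟨RingHom.ker ψ, hmax.isPrime⟩
    have hqmax : (q.comap (algebraMap R A)).asIdeal.IsMaximal := by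
      change ((RingHom.ker ψ).comap (algebraMap R A)).IsMaximal
      rw [hcomap hψ]
      exact RingHom.ker_isMaximal_of_surjective _ fun a =>
        ⟨MvPolynomial.C a, MvPolynomial.eval_C a⟩
    let Φ : Set (PrimeSpectrum A) := PrimeSpectrum.comap (algebraMap R A) ⁻¹'
      {q.comap (algebraMap R A)}
    have hΦ : IsClosed Φ := ((PrimeSpectrum.isClosed_singleton_iff_isMaximal _).mpr hqmax).preimage
      (PrimeSpectrum.continuous_comap _)
    have : JacobsonSpace Φ := JacobsonSpace.of_isClosedEmbedding hΦ.isClosedEmbedding_subtypeVal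
    have hclosed : (closedPoints Φ).Finite := by
      refine Set.Finite.of_finite_image (f := fun z => z.1.asIdeal) ?_ ?_
      · refine (hfin.image fun ψ => RingHom.ker ψ).subset ?_
        rintro _ ⟨z, hz, rfl⟩
        have hz' : IsClosed ({z.1} : Set (PrimeSpectrum A)) := by
          simpa using hΦ.isClosedEmbedding_subtypeVal.isClosedMap _ hz
        have := (PrimeSpectrum.isClosed_singleton_iff_isMaximal _).mp hz'
        obtain ⟨φ, hφ⟩ := exists_algHom_ker_eq z.1.asIdeal
        refine ⟨φ, fun i => ?_, hφ⟩
        have h1 : MvPolynomial.X i - MvPolynomial.C (c i) ∈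
            (PrimeSpectrum.comap (algebraMap R A) z.1).asIdeal := by
          rw [show PrimeSpectrum.comap (algebraMap R A) z.1 = q.comap (algebraMap R A) from z.2]
          change _ ∈ (RingHom.ker ψ).comap (algebraMap R A)
          rw [hcomap hψ]
          have : MvPolynomial.eval c (MvPolynomial.X i - MvPolynomial.C (c i)) = 0 := by simp
          exact this
        have h2 : algebraMap R A (MvPolynomial.X i - MvPolynomial.C (c i)) ∈ RingHom.ker φ := by
          rw [hφ]; exact h1
        have h3 : algebraMap R A (MvPolynomial.X i - MvPolynomial.C (c i)) =
            x i - algebraMap ℂ A (c i) := by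
          change MvPolynomial.aeval x _ = _
          simp
        rw [h3] at h2
        simpa [RingHom.mem_ker, sub_eq_zero] using h2
      · exact fun z _ w _ h => Subtype.ext (PrimeSpectrum.ext h)
    have : DiscreteTopology Φ := JacobsonSpace.discreteTopology hclosed
    have := Algebra.QuasiFiniteAt.of_isOpen_singleton_fiber (R := R) q
      (isOpen_discrete (α := Φ) _)
    exact .of_finiteType (R := R) q.asIdeal
  simp only [Algebra.zariskisMainProperty_iff] at hZ
  constructor
  · obtain ⟨ψ, hψ⟩ := hne
    obtain ⟨r, hr, hrint, hrm⟩ := hZ ψ hψ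
    have hr0 : r ≠ 0 := fun h => hr (h ▸ Ideal.zero_mem _)
    -- Integrality over the polynomial ring is integrality over its image.
    have hint : ∀ a : A, IsIntegral R a → IsIntegral (Algebra.adjoin ℂ (Set.range x)) a := by
      rintro a ⟨p, hp, hpa⟩
      have hmem : ∀ F : R, MvPolynomial.aeval x F ∈ Algebra.adjoin ℂ (Set.range x) := fun F => by
        rw [Algebra.adjoin_range_eq_range_aeval]; exact ⟨F, rfl⟩
      refine ⟨p.map ((MvPolynomial.aeval (R := ℂ) x).codRestrict _ hmem).toRingHom, hp.map _, ?_⟩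
      rw [Polynomial.eval₂_map]
      exact hpa
    refine ⟨fun a => ?_⟩
    obtain ⟨m, hm⟩ := hrm a
    exact IsAlgebraic.of_mul (mem_nonZeroDivisors_of_ne_zero (pow_ne_zero m hr0))
      (hint _ (hrint.pow m)).isAlgebraic (hint _ hm).isAlgebraic
  · -- For two points of the fibre some integral element takes different values; a general linear
    -- combination of such elements separates all points of the fibre.
    have := hfin.to_subtype
    let ι := {p : pointsOver x c × pointsOver x c // p.1 ≠ p.2}
    obtain ⟨θ, hθ, hθne⟩ := Module.Dual.exists_forall_mem_ne_zero_of_forall_exists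
      (K := ℂ) (ι := ι) (((integralClosure R A).toSubmodule).restrictScalars ℂ)
      (fun p => p.1.1.1.toLinearMap - p.1.2.1.toLinearMap) (by
        rintro ⟨⟨⟨ψ, hψ⟩, ⟨ψ', hψ'⟩⟩, hne⟩
        obtain ⟨r, hr, hrint, hrm⟩ := hZ ψ hψ
        by_contra! hall
        have hall' : ∀ a : A, IsIntegral R a → ψ a = ψ' a := fun a ha =>
          sub_eq_zero.mp (hall a ha)
        refine hne (Subtype.ext (AlgHom.ext fun a => ?_))
        obtain ⟨m, hm⟩ := hrm a
        have h1 := hall' _ hm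
        rw [map_mul, map_mul, ← hall' _ (hrint.pow m)] at h1
        refine mul_left_cancel₀ ?_ h1
        rw [map_pow]
        exact pow_ne_zero m hr)
    refine ⟨θ, hθ, fun ψ hψ ψ' hψ' h => ?_⟩
    by_contra hne
    exact hθne ⟨⟨⟨ψ, hψ⟩, ⟨ψ', hψ'⟩⟩, fun h => hne (congrArg Subtype.val h)⟩ (sub_eq_zero.mpr h)

end Nullstellensatz

section Specialization

open MvPolynomial Polynomial

/-- A complex point of a subring `D` of a field extends to any algebra whose elements become
elements of `D` after multiplication by powers of some `y` not vanishing at the point. -/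
lemma exists_algHom_of_pow_mul_mem {D A L : Type} [CommRing D] [CommRing A] [Field L]
    [Algebra ℂ D] [Algebra ℂ A] [Algebra ℂ L] (ι : D →ₐ[ℂ] L) (hι : Function.Injective ι)
    (f : A →ₐ[ℂ] L) (y : D) (hf : ∀ a, ∃ (m : ℕ) (d : D), ι d = ι y ^ m * f a)
    (χ : D →ₐ[ℂ] ℂ) (hy : χ y ≠ 0) :
    ∃ ψ : A →ₐ[ℂ] ℂ, ∀ (a : A) (m : ℕ) (d : D), ι d = ι y ^ m * f a → χ d = χ y ^ m * ψ a := by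
  choose m d hd using hf
  have key : ∀ (a : A) (k : ℕ) (e : D), ι e = ι y ^ k * f a →
      χ e = χ y ^ k * (χ (d a) / χ y ^ m a) := by
    intro a k e he
    have : y ^ m a * e = y ^ k * d a := hι (by
      rw [map_mul, map_mul, map_pow, map_pow, he, hd]; ring)
    have h := congrArg χ this
    rw [map_mul, map_mul, map_pow, map_pow] at h
    field_simp
    linear_combination h
  refine ⟨{ toFun := fun a => χ (d a) / χ y ^ m a
            map_one' := ?_
            map_mul' := fun a b => ?_
            map_zero' := ?_
            map_add' := fun a b => ?_
            commutes' := fun c => ?_ }, key⟩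
  · simpa using (key 1 0 1 (by simp)).symm
  · have h := key (a * b) (m a + m b) (d a * d b) (by rw [map_mul, hd, hd, map_mul]; ring)
    rw [map_mul] at h
    field_simp
    rw [pow_add] at h
    field_simp at h
    linear_combination -h
  · simpa using (key 0 0 0 (by simp)).symm
  · have h := key (a + b) (m a + m b) (y ^ m b * d a + y ^ m a * d b)
      (by rw [map_add, map_mul, map_mul, map_pow, map_pow, hd, hd, map_add]; ring)
    rw [map_add, map_mul, map_mul, map_pow, map_pow, pow_add] at h
    field_simp
    field_simp at h
    linear_combination -h
  · simpa using (key (algebraMap ℂ A c) 0 (algebraMap ℂ D c) (by simp)).symm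

section Lift

variable {R A L : Type} [CommRing R] [IsDomain R] [IsIntegrallyClosed R] [Algebra ℂ R]
  [CommRing A] [Algebra ℂ A] [Algebra R A]
  [Field L] [Algebra ℂ L] [Algebra R L] [IsScalarTower ℂ R L] [FaithfulSMul R L]

/-- In an integral extension, a root of the specialization of the minimal polynomial of `θ` is the
value of `θ` at some complex point. -/
lemma exists_algHom_of_isIntegral_of_root {D : Type} [CommRing D] [IsDomain D] [Algebra ℂ D]
    [Algebra R D] [IsScalarTower ℂ R D] [FaithfulSMul R D] [Algebra.IsIntegral R D] (θ : D)
    (ε : R →ₐ[ℂ] ℂ) (t : ℂ)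
    (ht : Polynomial.eval₂ (ε : R →+* ℂ) t (minpoly R θ) = 0) :
    ∃ χ : D →ₐ[ℂ] ℂ, (∀ F : R, χ (algebraMap R _ F) = ε F) ∧ χ θ = t := by
  have hθ : IsIntegral R θ := Algebra.IsIntegral.isIntegral θ
  -- As `R` is normal, `R[θ]` is `R[X]` modulo the minimal polynomial; the point of `R[θ]` with
  -- `θ ↦ t` is then extended to `D`.
  let C := Algebra.adjoin R {θ}
  let χ₀ : C →+* ℂ := (AdjoinRoot.lift (ε : R →+* ℂ) t ht).comp
    (minpoly.equivAdjoin hθ).symm.toRingEquiv.toRingHom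
  have hχR : ∀ F : R, χ₀ (algebraMap R C F) = ε F := by
    intro F
    change AdjoinRoot.lift _ t ht ((minpoly.equivAdjoin hθ).symm (algebraMap R C F)) = _
    rw [AlgEquiv.commutes, AdjoinRoot.algebraMap_eq, AdjoinRoot.lift_of]
    rfl
  have hχθ : χ₀ ⟨θ, Algebra.self_mem_adjoin_singleton R θ⟩ = t := by
    have : minpoly.equivAdjoin hθ (AdjoinRoot.root _) =
        ⟨θ, Algebra.self_mem_adjoin_singleton R θ⟩ := Subtype.ext (by simp)
    change AdjoinRoot.lift _ t ht ((minpoly.equivAdjoin hθ).symm _) = _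
    rw [← this, AlgEquiv.symm_apply_apply, AdjoinRoot.lift_root]
  let χ : C →ₐ[ℂ] ℂ := { χ₀ with
    commutes' := fun a => by
      change χ₀ (algebraMap ℂ C a) = a
      rw [IsScalarTower.algebraMap_apply ℂ R C, hχR, AlgHom.commutes]
      rfl }
  have : IsScalarTower ℂ C D := .of_algebraMap_eq fun a => rfl
  have : Algebra.IsIntegral C D := ⟨fun d => (Algebra.IsIntegral.isIntegral (R := R) d).tower_top⟩
  obtain ⟨χ', hχ'⟩ := exists_algHom_extension (C := C) (D := D) Subtype.val_injective χ
  exact ⟨χ', fun F => (hχ' _).trans (hχR F), (hχ' _).trans hχθ⟩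

/-- Off a hypersurface in the base, every root of the specialization of the minimal polynomial of
`θ` is the value of `θ` at some complex point of `A`, at which moreover `h` does not vanish. -/
lemma exists_forall_exists_algHom_of_root [Algebra.FiniteType ℂ A] [Algebra A L]
    [IsScalarTower R A L] [IsScalarTower ℂ A L] [FaithfulSMul A L] [Algebra.IsAlgebraic R L]
    (θ : A) (hθ : IsIntegral R θ) (h : A) (hh : h ≠ 0) :
    ∃ y : R, y ≠ 0 ∧ ∀ ε : R →ₐ[ℂ] ℂ, ε y ≠ 0 → ∀ t : ℂ,
      Polynomial.eval₂ (ε : R →+* ℂ) t (minpoly R θ) = 0 →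
      ∃ ψ : A →ₐ[ℂ] ℂ, (∀ F : R, ψ (algebraMap R A F) = ε F) ∧ ψ h ≠ 0 ∧ ψ θ = t := by
  classical
  have hAL : Function.Injective (algebraMap A L) := FaithfulSMul.algebraMap_injective A L
  obtain ⟨s, hs⟩ := Algebra.FiniteType.out (R := ℂ) (A := A)
  obtain ⟨y, hy0, hy⟩ := Algebra.IsAlgebraic.exists_integral_multiples R
    (insert (algebraMap A L h)⁻¹ (s.image (algebraMap A L)))
  refine ⟨y, hy0, fun ε hε t ht => ?_⟩
  -- `A` becomes integral over `R` after inverting `y`, so it suffices to extend points to the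
  -- integral closure of `R`.
  let D := integralClosure R L
  let θD : D := ⟨algebraMap A L θ, hθ.algebraMap⟩
  have hmin : minpoly R θD = minpoly R θ := by
    rw [← minpoly.algebraMap_eq hAL, ← minpoly.algebraMap_eq (B := D) (B' := L)
      Subtype.val_injective]
    rfl
  obtain ⟨χ, hχR, hχθ⟩ := exists_algHom_of_isIntegral_of_root θD ε t (hmin ▸ ht)
  let ι : D →ₐ[ℂ] L := D.val.restrictScalars ℂ
  let yD : D := algebraMap R D y
  have hιy : ι yD = algebraMap R L y := rfl
  have hyD : χ yD ≠ 0 := (hχR y).trans_ne hε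
  have hmul : ∀ a : A, ∃ (m : ℕ) (d : D), ι d = ι yD ^ m * IsScalarTower.toAlgHom ℂ A L a := by
    intro a
    have ha : a ∈ Algebra.adjoin ℂ (s : Set A) := hs ▸ Algebra.mem_top
    induction ha using Algebra.adjoin_induction with
    | mem a ha =>
      refine ⟨1, ⟨_, hy (algebraMap A L a) (Finset.mem_insert_of_mem
        (Finset.mem_image_of_mem _ ha))⟩, ?_⟩
      change y • algebraMap A L a = _
      rw [pow_one, hιy, Algebra.smul_def]
      rfl
    | algebraMap r => exact ⟨0, algebraMap ℂ D r, by simp⟩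
    | add a b _ _ ha hb =>
      obtain ⟨m, d, hd⟩ := ha
      obtain ⟨k, e, he⟩ := hb
      refine ⟨m + k, yD ^ k * d + yD ^ m * e, ?_⟩
      rw [map_add, map_mul, map_mul, map_pow, map_pow, hd, he, map_add]; ring
    | mul a b _ _ ha hb =>
      obtain ⟨m, d, hd⟩ := ha
      obtain ⟨k, e, he⟩ := hb
      exact ⟨m + k, d * e, by rw [map_mul, hd, he, map_mul]; ring⟩
  obtain ⟨ψ, hψ⟩ := exists_algHom_of_pow_mul_mem ι Subtype.val_injective
    (IsScalarTower.toAlgHom ℂ A L) yD hmul χ hyD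
  refine ⟨ψ, fun F => ?_, fun h0 => ?_, ?_⟩
  · have := hψ (algebraMap R A F) 0 (algebraMap R D F) (by
      rw [pow_zero, one_mul]; exact IsScalarTower.algebraMap_apply R A L F)
    rw [pow_zero, one_mul, hχR] at this
    exact this.symm
  · -- As `y * h⁻¹` lies in `D`, the value of `h` divides a power of the value of `y`.
    have hh' : algebraMap A L h ≠ 0 := by rwa [Ne, map_eq_zero_iff _ hAL]
    let u : D := ⟨_, hy (algebraMap A L h)⁻¹ (Finset.mem_insert_self _ _)⟩
    have hu : ι u = ι yD * (algebraMap A L h)⁻¹ := Algebra.smul_def _ _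
    obtain ⟨m, d, hd⟩ := hmul h
    have hud : u * d = yD ^ (m + 1) := by
      have : ι (u * d) = ι (yD ^ (m + 1)) := by
        rw [map_mul, hu, hd, map_pow, IsScalarTower.toAlgHom_apply]
        field_simp
        ring
      exact Subtype.val_injective this
    have := congrArg χ hud
    rw [map_mul, hψ h m d hd, h0, mul_zero, mul_zero, map_pow] at this
    exact pow_ne_zero _ hyD this.symm
  · have := hψ θ 0 θD (by rw [pow_zero, one_mul]; rfl)
    rw [pow_zero, one_mul, hχθ] at this
    exact this.symm

end Lift

/-- The number of points in a finite fibre of a generically finite morphism to affine space does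
not exceed the number of points in a generic fibre, even if one only counts the latter off a
hypersurface. -/
lemma generic_encard_pointsOver_le {A : Type} [CommRing A] [Algebra ℂ A] [Algebra.FiniteType ℂ A]
    [IsDomain A] {σ : Type} [Finite σ] (x : σ → A) (htr : Cardinal.mk σ ≤ Algebra.trdeg ℂ A)
    (c₀ : σ → ℂ) (hfin : (pointsOver x c₀).Finite) (h : A) (hh : h ≠ 0) :
    Generic fun c => (pointsOver x c₀).encard ≤ {ψ ∈ pointsOver x c | ψ h ≠ 0}.encard := by
  classical
  rcases (pointsOver x c₀).eq_empty_or_nonempty with hempty | hne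
  · exact .of_forall fun c => by simp [hempty]
  obtain ⟨halg, θ, hθ, hinj⟩ := exists_isIntegral_injOn x c₀ hfin hne
  have hb : IsTranscendenceBasis ℂ x :=
    Algebra.IsAlgebraic.isTranscendenceBasis_of_le_trdeg_of_finite ℂ x htr
  let R := MvPolynomial σ ℂ
  let : Algebra R A := (MvPolynomial.aeval (R := ℂ) x).toAlgebra
  have : IsScalarTower ℂ R A := .of_algebraMap_eq fun r => ((MvPolynomial.aeval x).commutes r).symm
  have hRA : Function.Injective (algebraMap R A) := hb.1
  have : FaithfulSMul R A := (faithfulSMul_iff_algebraMap_injective R A).mpr hRA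
  have : Algebra.IsAlgebraic R A := ⟨isAlgebraic_of_isTranscendenceBasis hb⟩
  let L := FractionRing A
  have : Algebra.IsAlgebraic R L := (IsFractionRing.isAlgebraic_iff' R A L).mp inferInstance
  let P := minpoly R θ
  have hP : P.Monic := minpoly.monic hθ
  have hPθ : Polynomial.eval₂ (algebraMap R A) θ P = 0 := minpoly.aeval R θ
  -- Specializing at `c₀`, the minimal polynomial of `θ` has distinct roots at the given points.
  have hdeg : (pointsOver x c₀).encard ≤ P.natDegree := by
    rw [← hinj.encard_image]
    have hsub : (fun ψ : A →ₐ[ℂ] ℂ => ψ θ) '' pointsOver x c₀ ⊆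
        (P.map (MvPolynomial.eval c₀)).roots.toFinset := by
      rintro _ ⟨ψ, hψ, rfl⟩
      refine Finset.mem_coe.mpr (Multiset.mem_toFinset.mpr ?_)
      rw [Polynomial.mem_roots (hP.map _).ne_zero, Polynomial.IsRoot, Polynomial.eval_map]
      have := congrArg ψ hPθ
      rw [map_zero, ← AlgHom.coe_toRingHom, Polynomial.hom_eval₂] at this
      have he : (ψ : A →+* ℂ).comp (algebraMap R A) = MvPolynomial.eval c₀ :=
        RingHom.ext fun F => pointsOver_aeval hψ F
      rwa [he] at this
    refine (Set.encard_le_encard hsub).trans ?_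
    rw [Set.encard_coe_eq_coe_finsetCard]
    exact Nat.cast_le.mpr ((Multiset.toFinset_card_le _).trans
      ((Polynomial.card_roots' _).trans (hP.natDegree_map _).le))
  have hroots := generic_card_roots P hP (by
    have hirr : Irreducible P := minpoly.irreducible hθ
    exact (hP.irreducible_iff_irreducible_map_fraction_map.mp hirr).separable)
  obtain ⟨y, hy0, hy⟩ := exists_forall_exists_algHom_of_root (R := R) (L := L) θ hθ h hh
  refine (hroots.and (Q := fun c => MvPolynomial.eval c y ≠ 0)
    ⟨y, hy0, fun _ => id⟩).mono fun c ⟨hc, hcy⟩ => hdeg.trans ?_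
  rw [← hc, ← Set.encard_coe_eq_coe_finsetCard]
  refine (Set.encard_le_encard ?_).trans (Set.encard_image_le (fun ψ : A →ₐ[ℂ] ℂ => ψ θ) _)
  intro t ht
  have ht : Polynomial.eval₂ (MvPolynomial.eval c) t P = 0 := by
    have := Multiset.mem_toFinset.mp (Finset.mem_coe.mp ht)
    rwa [Polynomial.mem_roots (hP.map _).ne_zero, Polynomial.IsRoot, Polynomial.eval_map] at this
  obtain ⟨ψ, hψR, hψh, hψθ⟩ := hy (MvPolynomial.aeval c) hcy t ht
  refine ⟨ψ, ⟨fun i => ?_, hψh⟩, hψθ⟩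
  have := hψR (MvPolynomial.X i)
  rwa [MvPolynomial.aeval_X, show algebraMap R A (MvPolynomial.X i) = x i from
    MvPolynomial.aeval_X x i] at this

end Specialization

/-! ### Generic systems of linear combinations of functions -/

section Incidence

open MvPolynomial

/-- Genericity of the parameters of systems with constant terms `c (i, none)` gives genericity of
the parameters of systems without: the constant terms are fixed at a general value, and then
absorbed by means of the coefficients `d`. -/
lemma Generic.of_option {n : ℕ} {ι : Type} {P : (Fin n × Option ι → ℂ) → Prop}
    {Q : (Fin n × ι → ℂ) → Prop} (hP : Generic P) (d : Fin n × ι → ℂ)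
    (h : ∀ c, P c → Q fun p => c (p.1, some p.2) + c (p.1, none) * d p) : Generic Q := by
  obtain ⟨F, hF, hP⟩ := hP
  obtain ⟨c₀, hc₀⟩ : ∃ c, eval c F ≠ 0 := by
    by_contra! hne
    exact hF (MvPolynomial.funext fun c => by simpa using hne c)
  let a : Fin n × Option ι → MvPolynomial (Fin n × ι) ℂ
    | (i, none) => C (c₀ (i, none))
    | (i, some j) => X (i, j) - C (c₀ (i, none) * d (i, j))
  have heval : ∀ c, eval c (bind₁ a F) = eval (fun k => eval c (a k)) F := by
    intro c
    rw [← coe_aeval_eq_eval, ← coe_aeval_eq_eval]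
    exact aeval_bind₁ _ _ _
  refine ⟨bind₁ a F, fun h0 => ?_, fun c hc => ?_⟩
  · have := heval fun p => c₀ (p.1, some p.2) + c₀ (p.1, none) * d p
    rw [h0, map_zero] at this
    refine hc₀ (this.symm ▸ congrArg (fun c => eval c F) ?_)
    funext ⟨i, j⟩
    cases j <;> simp [a]
  · rw [heval] at hc
    convert h _ (hP _ hc) using 1
    funext ⟨i, j⟩
    simp [a]

variable {B : Type} [CommRing B] [Algebra ℂ B] {n : ℕ} {ι : Type} [Fintype ι]

/-- The complex points of `Spec B` at which, for all `i`, the linear combination of the functions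
`g i j` with coefficients `c (i, j)` vanishes. -/
def solutions (g : Fin n → ι → B) (c : Fin n × ι → ℂ) : Set (B →ₐ[ℂ] ℂ) :=
  {φ | ∀ i, ∑ j, c (i, j) * φ (g i j) = 0}

/-- The parameters of the universal system with non-zero constant terms, as functions on its
incidence variety. For given points of `Spec B` and linear coefficients, the constant terms are
determined by the equations, so that the incidence variety is an affine space over `Spec B`. -/
noncomputable def incidenceParam (g : Fin n → ι → B) : Fin n × Option ι → MvPolynomial (Fin n × ι) B
  | (i, none) => -∑ j, X (i, j) * C (g i j)
  | (i, some j) => X (i, j)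

/-- The fibre of the incidence variety over a parameter `c` is the solution set of the system with
parameter `c`, also when one leaves out the zeros of `h`. -/
lemma image_pointsOver_incidenceParam (g : Fin n → ι → B) (c : Fin n × Option ι → ℂ) (h : B) :
    (fun ψ : MvPolynomial (Fin n × ι) B →ₐ[ℂ] ℂ =>
      ψ.comp (IsScalarTower.toAlgHom ℂ B (MvPolynomial (Fin n × ι) B))) ''
      {ψ ∈ pointsOver (incidenceParam g) c | ψ (C h) ≠ 0} =
    {φ | (∀ i, c (i, none) + ∑ j, c (i, some j) * φ (g i j) = 0) ∧ φ h ≠ 0} := by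
  ext φ
  constructor
  · rintro ⟨ψ, ⟨hψ, hh⟩, rfl⟩
    refine ⟨fun i => ?_, hh⟩
    have h1 := hψ (i, none)
    simp only [incidenceParam, map_neg, map_sum, map_mul] at h1
    rw [← h1, neg_add_eq_zero]
    refine Finset.sum_congr rfl fun j _ => ?_
    rw [show ψ (X (i, j)) = c (i, some j) from hψ (i, some j)]
    rfl
  · rintro ⟨hφ, hh⟩
    let ψ : MvPolynomial (Fin n × ι) B →ₐ[ℂ] ℂ :=
      { eval₂Hom (φ : B →+* ℂ) (fun p => c (p.1, some p.2)) with
        commutes' := fun a => by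
          change eval₂Hom (φ : B →+* ℂ) _ (algebraMap ℂ (MvPolynomial (Fin n × ι) B) a) = _
          rw [IsScalarTower.algebraMap_apply ℂ B, algebraMap_eq, eval₂Hom_C]
          exact φ.commutes a }
    have hC : ∀ b, ψ (C b) = φ b := fun b => eval₂Hom_C _ _ b
    have hX : ∀ p, ψ (X p) = c (p.1, some p.2) := fun p => eval₂Hom_X' _ _ p
    refine ⟨ψ, ⟨?_, by rwa [hC]⟩, AlgHom.ext hC⟩
    rintro ⟨i, _ | j⟩
    · simp only [incidenceParam, map_neg, map_sum, map_mul, hC, hX]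
      linear_combination -hφ i
    · exact hX (i, j)

lemma encard_pointsOver_incidenceParam (g : Fin n → ι → B) (c : Fin n × Option ι → ℂ) (h : B) :
    {ψ ∈ pointsOver (incidenceParam g) c | ψ (C h) ≠ 0}.encard =
    {φ : B →ₐ[ℂ] ℂ |
      (∀ i, c (i, none) + ∑ j, c (i, some j) * φ (g i j) = 0) ∧ φ h ≠ 0}.encard := by
  rw [← image_pointsOver_incidenceParam, Set.InjOn.encard_image]
  rintro ψ ⟨hψ, -⟩ ψ' ⟨hψ', -⟩ heq
  refine AlgHom.coe_ringHom_injective (MvPolynomial.ringHom_ext (fun b => ?_) fun ⟨i, j⟩ => ?_)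
  · exact DFunLike.congr_fun heq b
  · exact (hψ (i, some j)).trans (hψ' (i, some j)).symm

lemma trdeg_incidence [IsDomain B] (hB : Algebra.trdeg ℂ B = n) :
    Algebra.trdeg ℂ (MvPolynomial (Fin n × ι) B) = Cardinal.mk (Fin n × Option ι) := by
  have : FaithfulSMul ℂ B := inferInstance
  rw [← _root_.trdeg_add_eq ℂ B, hB, MvPolynomial.trdeg_of_isDomain]
  simp only [Cardinal.mk_fintype, Fintype.card_prod, Fintype.card_fin, Fintype.card_option,
    Cardinal.lift_natCast]
  push_cast
  ring

/-- Systems without constant terms, in which some combination `u` of the functions is invertible,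
are systems with constant terms after division by `u`. -/
lemma solutions_eq_of_isUnit (g : Fin n → ι → B) (d : Fin n × ι → ℂ) (w : Fin n → B)
    (hw : ∀ i, w i * ∑ j, algebraMap ℂ B (d (i, j)) * g i j = 1) (c : Fin n × Option ι → ℂ) :
    solutions g (fun p => c (p.1, some p.2) + c (p.1, none) * d p) =
    {φ | ∀ i, c (i, none) + ∑ j, c (i, some j) * φ (w i * g i j) = 0} := by
  ext φ
  refine forall_congr' fun i => ?_
  have hu := congrArg φ (hw i)
  simp only [map_mul, map_sum, AlgHom.commutes, map_one, Algebra.algebraMap_self_apply] at hu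
  have hw0 : φ (w i) ≠ 0 := left_ne_zero_of_mul (hu.trans_ne one_ne_zero)
  have : c (i, none) + ∑ j, c (i, some j) * φ (w i * g i j) =
      φ (w i) * ∑ j, (c (i, some j) + c (i, none) * d (i, j)) * φ (g i j) := by
    simp only [add_mul, Finset.sum_add_distrib, mul_add, map_mul]
    have h1 : φ (w i) * ∑ j, c (i, none) * d (i, j) * φ (g i j) = c (i, none) := by
      conv_rhs => rw [← mul_one (c (i, none)), ← hu]
      rw [Finset.mul_sum, Finset.mul_sum, Finset.mul_sum]
      exact Finset.sum_congr rfl fun j _ => by ring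
    rw [h1, Finset.mul_sum, add_comm]
    exact congrArg (· + _) (Finset.sum_congr rfl fun j _ => by ring)
  rw [this, mul_eq_zero, or_iff_right hw0]

variable [Algebra.FiniteType ℂ B]

lemma exists_bound_solutions_of_isDomain [IsDomain B] (hB : Algebra.trdeg ℂ B = n)
    (g : Fin n → ι → B) (d : Fin n × ι → ℂ)
    (hd : ∀ i, IsUnit (∑ j, algebraMap ℂ B (d (i, j)) * g i j)) :
    ∃ D : ℕ, Generic fun c => (solutions g c).encard ≤ D := by
  choose w hw using fun i => (hd i).exists_left_inv
  obtain ⟨D, hD⟩ := exists_bound_pointsOver (incidenceParam fun i j => w i * g i j)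
    (trdeg_incidence hB).le
  refine ⟨D, hD.of_option d fun c hc => ?_⟩
  have := encard_pointsOver_incidenceParam (fun i j => w i * g i j) c 1
  simp only [map_one, ne_eq, one_ne_zero, not_false_eq_true, and_true] at this
  rw [solutions_eq_of_isUnit g d w hw, ← this]
  exact hc

lemma generic_encard_solutions_le_of_isDomain [IsDomain B] (hB : Algebra.trdeg ℂ B = n)
    (g : Fin n → ι → B) (d : Fin n × ι → ℂ)
    (hd : ∀ i, IsUnit (∑ j, algebraMap ℂ B (d (i, j)) * g i j)) (c₀ : Fin n × ι → ℂ)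
    (hfin : (solutions g c₀).Finite) (h : B) (hh : h ≠ 0) :
    Generic fun c => (solutions g c₀).encard ≤ {φ ∈ solutions g c | φ h ≠ 0}.encard := by
  choose w hw using fun i => (hd i).exists_left_inv
  let x := incidenceParam fun i j => w i * g i j
  have key : ∀ c : Fin n × Option ι → ℂ,
      {φ ∈ solutions g (fun p => c (p.1, some p.2) + c (p.1, none) * d p) | φ h ≠ 0}.encard =
        {ψ ∈ pointsOver x c | ψ (C h) ≠ 0}.encard := fun c => by
    rw [encard_pointsOver_incidenceParam, solutions_eq_of_isUnit g d w hw]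
    rfl
  -- The system of `c₀` is the one with zero constant terms.
  let c₁ : Fin n × Option ι → ℂ := fun p => p.2.elim 0 fun j => c₀ (p.1, j)
  have h₁ : (pointsOver x c₁).encard = (solutions g c₀).encard := by
    have h1 := encard_pointsOver_incidenceParam (fun i j => w i * g i j) c₁ 1
    simp only [map_one, ne_eq, one_ne_zero, not_false_eq_true, and_true] at h1
    have h2 := solutions_eq_of_isUnit g d w hw c₁
    exact h1.trans (by rw [← h2]; simp [c₁])
  have := generic_encard_pointsOver_le x (trdeg_incidence hB).ge c₁
    (Set.encard_lt_top_iff.mp (h₁ ▸ Set.encard_lt_top_iff.mpr hfin)) (C h)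
    ((map_ne_zero_iff _ (C_injective _ _)).mpr hh)
  refine this.of_option d fun c hc => ?_
  rw [key, ← h₁]
  exact hc

end Incidence

section Components

variable {B : Type} [CommRing B] [Algebra ℂ B] {n : ℕ} {ι : Type} [Fintype ι]

/-- The solutions on the closed subscheme `V(p)`. -/
lemma image_solutions_quotient (p : Ideal B) (g : Fin n → ι → B) (c : Fin n × ι → ℂ) (h : B) :
    (fun φ : B ⧸ p →ₐ[ℂ] ℂ => φ.comp (Ideal.Quotient.mkₐ ℂ p)) ''
      {φ ∈ solutions (fun i j => Ideal.Quotient.mk p (g i j)) c | φ (Ideal.Quotient.mk p h) ≠ 0} =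
      {φ ∈ solutions g c | p ≤ RingHom.ker φ ∧ φ h ≠ 0} := by
  ext φ
  constructor
  · rintro ⟨φ, ⟨hφ, hh⟩, rfl⟩
    refine ⟨hφ, fun b hb => ?_, hh⟩
    change φ (Ideal.Quotient.mk p b) = 0
    rw [Ideal.Quotient.eq_zero_iff_mem.mpr hb, map_zero]
  · rintro ⟨hφ, hp, hh⟩
    exact ⟨Ideal.Quotient.liftₐ p φ hp, ⟨hφ, hh⟩, AlgHom.ext fun b => rfl⟩

lemma encard_solutions_quotient (p : Ideal B) (g : Fin n → ι → B) (c : Fin n × ι → ℂ) (h : B) :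
    {φ ∈ solutions (fun i j => Ideal.Quotient.mk p (g i j)) c |
      φ (Ideal.Quotient.mk p h) ≠ 0}.encard =
      {φ ∈ solutions g c | p ≤ RingHom.ker φ ∧ φ h ≠ 0}.encard := by
  rw [← image_solutions_quotient, Function.Injective.encard_image]
  exact fun φ φ' h => AlgHom.coe_ringHom_injective
    (Ideal.Quotient.ringHom_ext (congrArg (fun ψ : B →ₐ[ℂ] ℂ => (ψ : B →+* ℂ)) h))

lemma encard_solutions_quotient' (p : Ideal B) (g : Fin n → ι → B) (c : Fin n × ι → ℂ) :
    (solutions (fun i j => Ideal.Quotient.mk p (g i j)) c).encard =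
      {φ ∈ solutions g c | p ≤ RingHom.ker φ}.encard := by
  simpa using encard_solutions_quotient p g c 1

lemma isUnit_quotient (p : Ideal B) (g : Fin n → ι → B) (d : Fin n × ι → ℂ) {i : Fin n}
    (hd : IsUnit (∑ j, algebraMap ℂ B (d (i, j)) * g i j)) :
    IsUnit (∑ j, algebraMap ℂ (B ⧸ p) (d (i, j)) * Ideal.Quotient.mk p (g i j)) := by
  have := hd.map (Ideal.Quotient.mk p)
  rwa [map_sum] at this

lemma exists_minimalPrimes_le_ker (φ : B →ₐ[ℂ] ℂ) : ∃ p ∈ minimalPrimes B, p ≤ RingHom.ker φ := by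
  have := (ker_algHom_isMaximal φ).isPrime
  exact Ideal.exists_minimalPrimes_le bot_le

variable [Algebra.FiniteType ℂ B]

/-- A generic system has a bounded number of solutions. -/
lemma exists_bound_solutions (hB : ∀ p ∈ minimalPrimes B, Algebra.trdeg ℂ (B ⧸ p) = n)
    (g : Fin n → ι → B) (d : Fin n × ι → ℂ)
    (hd : ∀ i, IsUnit (∑ j, algebraMap ℂ B (d (i, j)) * g i j)) :
    ∃ D : ℕ, Generic fun c => (solutions g c).encard ≤ D := by
  have : IsNoetherianRing B := Algebra.FiniteType.isNoetherianRing ℂ B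
  have hfin := minimalPrimes.finite_of_isNoetherianRing B
  have key : ∀ p ∈ hfin.toFinset, ∃ D : ℕ, Generic fun c =>
      {φ ∈ solutions g c | p ≤ RingHom.ker φ}.encard ≤ D := by
    intro p hp
    rw [Set.Finite.mem_toFinset] at hp
    have := hp.1.1
    simp only [← encard_solutions_quotient']
    exact exists_bound_solutions_of_isDomain (hB p hp) _ d fun i => isUnit_quotient p g d (hd i)
  choose! D hD using key
  refine ⟨∑ p ∈ hfin.toFinset, D p, (Generic.finset_forall _ hD).mono fun c hc => ?_⟩
  have hsub : solutions g c ⊆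
      ⋃ p ∈ hfin.toFinset, {φ ∈ solutions g c | p ≤ RingHom.ker φ} := by
    intro φ hφ
    obtain ⟨p, hp, hpφ⟩ := exists_minimalPrimes_le_ker φ
    exact Set.mem_biUnion (hfin.mem_toFinset.mpr hp) ⟨hφ, hpφ⟩
  refine (Set.encard_le_encard hsub).trans ((Finset.set_encard_biUnion_le _ _).trans ?_)
  rw [Nat.cast_sum]
  exact Finset.sum_le_sum hc

/-- A system with finitely many solutions has no more of them than a generic system has off
`V(I)`, where `V(I)` contains no irreducible component. -/
lemma generic_encard_solutions_le (hB : ∀ p ∈ minimalPrimes B, Algebra.trdeg ℂ (B ⧸ p) = n)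
    (g : Fin n → ι → B) (d : Fin n × ι → ℂ)
    (hd : ∀ i, IsUnit (∑ j, algebraMap ℂ B (d (i, j)) * g i j)) (c₀ : Fin n × ι → ℂ)
    (hfin : (solutions g c₀).Finite) (I : Ideal B) (hI : ∀ p ∈ minimalPrimes B, ¬ I ≤ p) :
    Generic fun c => (solutions g c₀).encard ≤ {φ ∈ solutions g c | ¬ I ≤ RingHom.ker φ}.encard := by
  classical
  have : IsNoetherianRing B := Algebra.FiniteType.isNoetherianRing ℂ B
  have hmin := minimalPrimes.finite_of_isNoetherianRing B
  -- `h p` vanishes on `V(I)` and on all components but the one of `p`.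
  have hex : ∀ p ∈ hmin.toFinset, ∃ h : B, h ∈ I ∧ (∀ q ∈ minimalPrimes B, q ≠ p → h ∈ q) ∧
      h ∉ p := by
    intro p hp
    rw [Set.Finite.mem_toFinset] at hp
    have hprime := hp.1.1
    have : ¬ I ⊓ (hmin.toFinset.erase p).inf id ≤ p := by
      rw [hprime.inf_le, not_or]
      refine ⟨hI p hp, fun hle => ?_⟩
      obtain ⟨q, hq, hqp⟩ := (Ideal.IsPrime.inf_le' hprime).mp hle
      obtain ⟨hne, hq⟩ := Finset.mem_erase.mp hq
      rw [Set.Finite.mem_toFinset] at hq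
      exact hne (le_antisymm hqp (hp.2 hq.1 hqp))
    obtain ⟨h, hh, hhp⟩ := SetLike.not_le_iff_exists.mp this
    rw [Submodule.mem_inf] at hh
    refine ⟨h, hh.1, fun q hq hne => ?_, hhp⟩
    exact (Submodule.mem_finsetInf.mp hh.2) q
      (Finset.mem_erase.mpr ⟨hne, hmin.mem_toFinset.mpr hq⟩)
  choose! h hhI hhq hhp using hex
  have key : ∀ p ∈ hmin.toFinset, Generic fun c =>
      {φ ∈ solutions g c₀ | p ≤ RingHom.ker φ}.encard ≤
        {φ ∈ solutions g c | p ≤ RingHom.ker φ ∧ φ (h p) ≠ 0}.encard := by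
    intro p hp
    have hp' := hmin.mem_toFinset.mp hp
    have := hp'.1.1
    simp only [← encard_solutions_quotient', ← encard_solutions_quotient]
    refine generic_encard_solutions_le_of_isDomain (hB p hp') _ d
      (fun i => isUnit_quotient p g d (hd i)) c₀ ?_ _
      (fun h0 => hhp p hp (Ideal.Quotient.eq_zero_iff_mem.mp h0))
    rw [← Set.encard_lt_top_iff, encard_solutions_quotient']
    exact Set.encard_lt_top_iff.mpr (hfin.subset (Set.sep_subset _ _))
  refine (Generic.finset_forall _ key).mono fun c hc => ?_
  have hsub : solutions g c₀ ⊆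
      ⋃ p ∈ hmin.toFinset, {φ ∈ solutions g c₀ | p ≤ RingHom.ker φ} := by
    intro φ hφ
    obtain ⟨p, hp, hpφ⟩ := exists_minimalPrimes_le_ker φ
    exact Set.mem_biUnion (hmin.mem_toFinset.mpr hp) ⟨hφ, hpφ⟩
  refine (Set.encard_le_encard hsub).trans ((Finset.set_encard_biUnion_le _ _).trans
    ((Finset.sum_le_sum hc).trans ?_))
  rw [← finsum_mem_coe_finset, ← Set.Finite.encard_biUnion (Finset.finite_toSet _)]
  · refine Set.encard_le_encard (Set.iUnion₂_subset fun p hp φ ⟨hφ, _, hφh⟩ => ⟨hφ, fun hle => ?_⟩)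
    exact hφh (hle (hhI p hp))
  · rintro p hp q hq hne
    refine Set.disjoint_left.mpr fun φ ⟨_, hpφ, hφp⟩ ⟨_, hqφ, _⟩ => hφp (hqφ ?_)
    exact hhq p hp q (hmin.mem_toFinset.mp hq) hne.symm

end Components

/-! ### Dimension -/

section Dimension

/-- Injective integral extensions preserve the Krull dimension. -/
lemma ringKrullDim_eq_of_isIntegral {R S : Type} [CommRing R] [CommRing S] [Algebra R S]
    [Algebra.IsIntegral R S] [FaithfulSMul R S] : ringKrullDim S = ringKrullDim R := by
  apply le_antisymm
  · refine Order.krullDim_le_of_strictMono (PrimeSpectrum.comap (algebraMap R S)) fun p q hpq => ?_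
    exact Ideal.IsIntegral.comap_lt_comap (R := R) hpq
  · refine iSup_le fun l => ?_
    obtain ⟨⟨P, hP, hPl⟩⟩ := Ideal.nonempty_primesOver (S := S) l.head.asIdeal
    obtain ⟨l', hl', -⟩ := Ideal.exists_ltSeries_of_hasGoingUp l P
    rw [← hl']
    exact Order.LTSeries.length_le_krullDim l'

/-- The Krull dimension of an affine domain is its transcendence degree. -/
lemma exists_ringKrullDim_eq_and_trdeg_eq (B : Type) [CommRing B] [IsDomain B] [Algebra ℂ B]
    [Algebra.FiniteType ℂ B] : ∃ m : ℕ, ringKrullDim B = m ∧ Algebra.trdeg ℂ B = m := by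
  obtain ⟨m, g, hg, hgi⟩ := exists_integral_inj_algHom_of_fg ℂ B
  let : Algebra (MvPolynomial (Fin m) ℂ) B := g.toAlgebra
  have : IsScalarTower ℂ (MvPolynomial (Fin m) ℂ) B := .of_algebraMap_eq fun r => (g.commutes r).symm
  have : FaithfulSMul (MvPolynomial (Fin m) ℂ) B := (faithfulSMul_iff_algebraMap_injective _ _).mpr hg
  have : Algebra.IsIntegral (MvPolynomial (Fin m) ℂ) B := ⟨hgi⟩
  refine ⟨m, ?_, ?_⟩
  · rw [ringKrullDim_eq_of_isIntegral (R := MvPolynomial (Fin m) ℂ)]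
    simp
  · rw [← trdeg_add_eq ℂ (MvPolynomial (Fin m) ℂ), MvPolynomial.trdeg_of_isDomain,
      _root_.trdeg_eq_zero]
    simp

/-- The dimension of a space is at most `m` if this holds locally. -/
lemma topologicalKrullDim_le_of_forall_exists {Z : Type} [TopologicalSpace Z] {m : WithBot ℕ∞}
    (h : ∀ z : Z, ∃ (T : Type) (_ : TopologicalSpace T) (j : T → Z),
      Topology.IsOpenEmbedding j ∧ z ∈ Set.range j ∧ topologicalKrullDim T ≤ m) :
    topologicalKrullDim Z ≤ m := by
  refine iSup_le fun l => ?_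
  obtain ⟨z, hz⟩ := l.head.isIrreducible.nonempty
  obtain ⟨T, _, j, hj, ⟨t, rfl⟩, hT⟩ := h z
  refine le_trans ?_ hT
  have hmem : ∀ i, j t ∈ (l i : Set Z) := fun i => l.monotone (Fin.zero_le i) hz
  let l' : LTSeries (IrreducibleCloseds T) :=
    { length := l.length
      toFun := fun i => ⟨j ⁻¹' (l i), ⟨⟨t, hmem i⟩, (l i).isIrreducible.2.preimage hj⟩,
        (l i).isClosed.preimage hj.continuous⟩
      step := fun i => by
        change (_ : IrreducibleCloseds T) < _
        have hlt : (l i.castSucc : Set Z) ⊂ l i.succ := l.step i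
        refine lt_of_le_of_ne (fun x hx => hlt.1 hx) fun heq => hlt.2 ?_
        have heq' : j ⁻¹' (l i.castSucc) = j ⁻¹' (l i.succ) :=
          congrArg (fun s : IrreducibleCloseds T => (s : Set T)) heq
        have hcl : (l i.succ : Set Z) ⊆ closure (l i.succ ∩ Set.range j) :=
          subset_closure_inter_of_isPreirreducible_of_isOpen (l i.succ).isIrreducible.2
            hj.isOpen_range ⟨_, hmem i.succ, ⟨t, rfl⟩⟩
        refine hcl.trans (closure_minimal ?_ (l i.castSucc).isClosed)
        rintro _ ⟨hx, ⟨x, rfl⟩⟩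
        exact heq'.ge hx }
  exact Order.LTSeries.length_le_krullDim l'

/-- The transcendence degree of a domain may be computed in any overring consisting of
fractions. -/
lemma trdeg_eq_of_forall_mul_mem {B K : Type} [CommRing B] [Field K] [Algebra ℂ B] [Algebra ℂ K]
    (f : B →ₐ[ℂ] K) (hf : ∀ k : K, ∃ a b : B, f b ≠ 0 ∧ f b * k = f a) :
    Algebra.trdeg ℂ (B ⧸ RingHom.ker f) = Algebra.trdeg ℂ K := by
  let g : B ⧸ RingHom.ker f →ₐ[ℂ] K := Ideal.kerLiftAlg f
  have hg : Function.Injective g := Ideal.kerLiftAlg_injective f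
  let : Algebra (B ⧸ RingHom.ker f) K := g.toAlgebra
  have : IsScalarTower ℂ (B ⧸ RingHom.ker f) K := .of_algebraMap_eq fun r => (g.commutes r).symm
  have : FaithfulSMul (B ⧸ RingHom.ker f) K := (faithfulSMul_iff_algebraMap_injective _ _).mpr hg
  have : IsDomain (B ⧸ RingHom.ker f) := hg.isDomain g
  have : Algebra.IsAlgebraic (B ⧸ RingHom.ker f) K := ⟨fun k => by
    obtain ⟨a, b, hb, hab⟩ := hf k
    refine ⟨Polynomial.C (Ideal.Quotient.mk _ b) * Polynomial.X -
      Polynomial.C (Ideal.Quotient.mk _ a), fun h0 => hb ?_, ?_⟩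
    · have := congrArg (Polynomial.coeff · 1) h0
      simp only [Polynomial.coeff_sub, Polynomial.coeff_C_mul, Polynomial.coeff_X_one, mul_one,
        Polynomial.coeff_C_succ, sub_zero, Polynomial.coeff_zero] at this
      rwa [Ideal.Quotient.eq_zero_iff_mem] at this
    · simp only [map_sub, map_mul, Polynomial.aeval_C, Polynomial.aeval_X]
      exact sub_eq_zero.mpr hab⟩
  have : FaithfulSMul ℂ (B ⧸ RingHom.ker f) :=
    (faithfulSMul_iff_algebraMap_injective _ _).mpr (algebraMap ℂ (B ⧸ RingHom.ker f)).injective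
  rw [← trdeg_add_eq ℂ (B ⧸ RingHom.ker f) (A := K),
    _root_.trdeg_eq_zero (R := B ⧸ RingHom.ker f) (A := K), add_zero]

end Dimension

/-! ### Affine open subsets of complex varieties -/

section Affine

variable {X : Scheme.{0}}

lemma fromSpec_mem {W : X.Opens} (hW : IsAffineOpen W) (y : PrimeSpectrum Γ(X, W)) :
    hW.fromSpec y ∈ W :=
  hW.range_fromSpec.le ⟨y, rfl⟩

lemma fromSpec_mem_basicOpen {W : X.Opens} (hW : IsAffineOpen W) (y : PrimeSpectrum Γ(X, W))
    (s : Γ(X, W)) : hW.fromSpec y ∈ X.basicOpen s ↔ s ∉ y.asIdeal := by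
  change y ∈ hW.fromSpec ⁻¹ᵁ X.basicOpen s ↔ _
  rw [hW.fromSpec_preimage_basicOpen]
  rfl

lemma exists_fromSpec_eq {W : X.Opens} (hW : IsAffineOpen W) {x : X} (hx : x ∈ W) :
    ∃ y : PrimeSpectrum Γ(X, W), hW.fromSpec y = x :=
  hW.range_fromSpec.ge hx

lemma fromSpec_mem_genericPoints_iff {W : X.Opens} (hW : IsAffineOpen W)
    (y : PrimeSpectrum Γ(X, W)) :
    hW.fromSpec y ∈ genericPoints X ↔ y.asIdeal ∈ minimalPrimes Γ(X, W) := by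
  refine ((map_mem_genericPoints_iff hW.fromSpec y).trans mem_genericPoints_iff).trans ?_
  constructor
  · refine fun h => ⟨⟨y.2, bot_le⟩, fun p hp hpy => ?_⟩
    have h1 := h ⟨p, hp.1⟩ ((PrimeSpectrum.le_iff_specializes ⟨p, hp.1⟩ y).mp hpy)
    exact (PrimeSpectrum.le_iff_specializes y ⟨p, hp.1⟩).mpr h1
  · intro h z hz
    have h1 := (PrimeSpectrum.le_iff_specializes z y).mpr hz
    exact (PrimeSpectrum.le_iff_specializes y z).mp (h.2 ⟨z.2, bot_le⟩ h1)

variable [X.Over SpecC]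

/-- The complex structure of the residue fields. -/
noncomputable abbrev residueAlgebra (x : X) : Algebra ℂ (X.residueField x) :=
  ((X.evaluation ⊤ x trivial).hom.comp (constHom ⊤)).toAlgebra

lemma evaluation_constHom (W : X.Opens) (x : X) (hx : x ∈ W) (c : ℂ) :
    X.evaluation W x hx (constHom W c) = X.evaluation ⊤ x trivial (constHom ⊤ c) := by
  have := congrArg (X.residue x) (germ_constHom x hx (Opens.mem_top x) c)
  exact this

/-- The transcendence degree of the coordinate ring of an affine piece of an irreducible component
is that of the residue field at the generic point. -/
lemma trdeg_quotient_eq_trdeg_residueField {W : X.Opens} (hW : IsAffineOpen W)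
    (y : PrimeSpectrum Γ(X, W)) (x : X) (hx : hW.fromSpec y = x) :
    letI := residueAlgebra x
    Algebra.trdeg ℂ (Γ(X, W) ⧸ y.asIdeal) = Algebra.trdeg ℂ (X.residueField x) := by
  let := residueAlgebra x
  have hxW : x ∈ W := hx ▸ fromSpec_mem hW y
  let f : Γ(X, W) →ₐ[ℂ] X.residueField x :=
    { (X.evaluation W x hxW).hom with commutes' := evaluation_constHom W x hxW }
  have hker : RingHom.ker f = y.asIdeal := by
    ext s
    change X.evaluation W x hxW s = 0 ↔ _
    rw [X.evaluation_eq_zero_iff_notMem_basicOpen, ← hx, fromSpec_mem_basicOpen, not_not]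
  rw [← hker]
  refine trdeg_eq_of_forall_mul_mem f fun k => ?_
  obtain ⟨k, rfl⟩ := X.residue_surjective x k
  let := TopCat.Presheaf.algebra_section_stalk X.presheaf ⟨x, hxW⟩
  have hloc := hW.isLocalization_stalk ⟨x, hxW⟩
  obtain ⟨⟨a, b⟩, hab⟩ := IsLocalization.surj (hW.primeIdealOf ⟨x, hxW⟩).asIdeal.primeCompl k
  refine ⟨a, b, fun h0 => b.2 ?_, ?_⟩
  · have h1 : (b : Γ(X, W)) ∈ RingHom.ker f := h0
    rw [hker] at h1
    have h2 : hW.primeIdealOf ⟨x, hxW⟩ = y :=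
      hW.fromSpec.isOpenEmbedding.injective ((hW.fromSpec_primeIdealOf ⟨x, hxW⟩).trans hx.symm)
    have h3 : ∀ s : Γ(X, W), s ∈ y.asIdeal → s ∈ (hW.primeIdealOf ⟨x, hxW⟩).asIdeal := by
      rw [h2]; exact fun _ h => h
    exact h3 _ h1
  · have := congrArg (X.residue x) hab
    rw [map_mul] at this
    rw [mul_comm]
    exact this

lemma finiteType_section [LocallyOfFiniteType (X ↘ SpecC)] {W : X.Opens} (hW : IsAffineOpen W) :
    Algebra.FiniteType ℂ Γ(X, W) := by
  have h := (X ↘ SpecC).finiteType_appLE (isAffineOpen_top _) hW le_top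
  exact h.comp (RingHom.FiniteType.of_surjective (Scheme.ΓSpecIso (CommRingCat.of ℂ)).inv.hom
    (Scheme.ΓSpecIso (CommRingCat.of ℂ)).symm.commRingCatIsoToRingEquiv.surjective)

/-- On a variety of pure dimension `n`, the coordinate rings of the irreducible components of
affine open subsets have transcendence degree `n`. -/
lemma trdeg_quotient_minimalPrimes [LocallyOfFiniteType (X ↘ SpecC)] {n : ℕ} (hX : IsPureDim X n)
    {W : X.Opens} (hW : IsAffineOpen W) (p : Ideal Γ(X, W)) (hp : p ∈ minimalPrimes Γ(X, W)) :
    Algebra.trdeg ℂ (Γ(X, W) ⧸ p) = n := by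
  let y : PrimeSpectrum Γ(X, W) := ⟨p, hp.1.1⟩
  let η : X := hW.fromSpec y
  have hη : η ∈ genericPoints X := (fromSpec_mem_genericPoints_iff hW y).mpr hp
  let Z : Set X := closure {η}
  have hZ : topologicalKrullDim Z = n := hX Z hη
  let := residueAlgebra η
  -- The affine pieces of `Z`, as spectra of domains of the same transcendence degree.
  have key : ∀ (V : X.Opens) (hV : IsAffineOpen V) (v : PrimeSpectrum Γ(X, V)),
      hV.fromSpec v = η → ∃ m : ℕ, Algebra.trdeg ℂ (X.residueField η) = m ∧
      topologicalKrullDim (PrimeSpectrum (Γ(X, V) ⧸ v.asIdeal)) = m ∧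
      ∃ j : PrimeSpectrum (Γ(X, V) ⧸ v.asIdeal) → Z, Topology.IsOpenEmbedding j ∧
        ∀ z : Z, z.1 ∈ V → z ∈ Set.range j := by
    intro V hV v hv
    have := finiteType_section hV
    obtain ⟨m, hm, hm'⟩ := exists_ringKrullDim_eq_and_trdeg_eq (Γ(X, V) ⧸ v.asIdeal)
    rw [trdeg_quotient_eq_trdeg_residueField hV v η hv] at hm'
    refine ⟨m, hm', by rw [PrimeSpectrum.topologicalKrullDim_eq_ringKrullDim, hm], ?_⟩
    have hemb := PrimeSpectrum.isClosedEmbedding_comap_of_surjective _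
      (Ideal.Quotient.mk v.asIdeal) Ideal.Quotient.mk_surjective
    have hrange : Set.range (PrimeSpectrum.comap (Ideal.Quotient.mk v.asIdeal)) =
        PrimeSpectrum.zeroLocus v.asIdeal := by
      rw [range_comap_of_surjective _ _ Ideal.Quotient.mk_surjective,
        Ideal.mk_ker]
    let e : PrimeSpectrum (Γ(X, V) ⧸ v.asIdeal) → X := fun q =>
      hV.fromSpec (PrimeSpectrum.comap (Ideal.Quotient.mk v.asIdeal) q)
    have he : Topology.IsEmbedding e :=
      hV.fromSpec.isOpenEmbedding.isEmbedding.comp hemb.isEmbedding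
    have hiff : ∀ x : X, x ∈ Set.range e ↔ x ∈ Z ∧ x ∈ V := by
      intro x
      constructor
      · rintro ⟨q, rfl⟩
        refine ⟨?_, fromSpec_mem hV _⟩
        have hq : PrimeSpectrum.comap (Ideal.Quotient.mk v.asIdeal) q ∈
            PrimeSpectrum.zeroLocus v.asIdeal := hrange.le ⟨q, rfl⟩
        have h1 : v ⤳ PrimeSpectrum.comap (Ideal.Quotient.mk v.asIdeal) q :=
          (PrimeSpectrum.le_iff_specializes _ _).mp hq
        have h2 := h1.map hV.fromSpec.continuous
        rw [hv] at h2
        exact specializes_iff_mem_closure.mp h2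
      · rintro ⟨hxZ, hxV⟩
        obtain ⟨u, rfl⟩ := exists_fromSpec_eq hV hxV
        have h1 : hV.fromSpec v ⤳ hV.fromSpec u := by
          rw [hv]; exact specializes_iff_mem_closure.mpr hxZ
        have h2 := hV.fromSpec.isOpenEmbedding.isInducing.specializes_iff.mp h1
        have h3 : u ∈ PrimeSpectrum.zeroLocus (v.asIdeal : Set Γ(X, V)) :=
          (PrimeSpectrum.le_iff_specializes v u).mpr h2
        rw [← hrange] at h3
        obtain ⟨q, rfl⟩ := h3
        exact ⟨q, rfl⟩
    refine ⟨Set.codRestrict e Z fun q => ((hiff _).mp ⟨q, rfl⟩).1,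
      ⟨he.codRestrict Z _, ?_⟩, fun z hz => ?_⟩
    · have : Set.range (Set.codRestrict e Z fun q => ((hiff _).mp ⟨q, rfl⟩).1) =
          Subtype.val ⁻¹' (V : Set X) := by
        ext z
        constructor
        · rintro ⟨q, rfl⟩
          exact ((hiff _).mp ⟨q, rfl⟩).2
        · intro hz
          obtain ⟨q, hq⟩ := (hiff z.1).mpr ⟨z.2, hz⟩
          exact ⟨q, Subtype.ext hq⟩
      rw [this]
      exact V.isOpen.preimage continuous_subtype_val
    · obtain ⟨q, hq⟩ := (hiff z.1).mpr ⟨z.2, hz⟩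
      exact ⟨q, Subtype.ext hq⟩
  obtain ⟨m, hm, hdim, j, hj, -⟩ := key W hW y rfl
  have htr := trdeg_quotient_eq_trdeg_residueField hW y η rfl
  rw [show p = y.asIdeal from rfl, htr, hm]
  have hle : (m : WithBot ℕ∞) ≤ n := by
    rw [← hdim, ← hZ]
    exact hj.isInducing.topologicalKrullDim_le
  have hge : (n : WithBot ℕ∞) ≤ m := by
    rw [← hZ]
    refine topologicalKrullDim_le_of_forall_exists fun z => ?_
    obtain ⟨V, hV, hzV, -⟩ := exists_isAffineOpen_mem_and_subset (x := z.1) (U := ⊤) trivial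
    have hηV : η ∈ V := (specializes_iff_mem_closure.mpr z.2).mem_open V.isOpen hzV
    obtain ⟨v, hv⟩ := exists_fromSpec_eq hV hηV
    obtain ⟨m', hm', hdim', j', hj', hr'⟩ := key V hV v hv
    have : (m' : Cardinal) = m := hm'.symm.trans hm
    refine ⟨_, _, j', hj', hr' z hzV, ?_⟩
    rw [hdim', Nat.cast_inj.mp this]
  have : m = n := le_antisymm (by exact_mod_cast hle) (by exact_mod_cast hge)
  rw [this]

end Affine

/-! ### Affine neighbourhoods of finite sets -/

attribute [local instance] MvPolynomial.gradedAlgebra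

/-- Finitely many points of projective space avoid a common hyperplane. -/
lemma exists_linearForm_forall_mem_basicOpen {N : ℕ} (T : Set (ProjC N)) (hT : T.Finite) :
    ∃ l ∈ MvPolynomial.homogeneousSubmodule (Fin (N + 1)) ℂ 1,
      ∀ t ∈ T, t ∈ Proj.basicOpen (MvPolynomial.homogeneousSubmodule (Fin (N + 1)) ℂ) l := by
  have := hT.to_subtype
  let P : T → Submodule ℂ (MvPolynomial.homogeneousSubmodule (Fin (N + 1)) ℂ 1) := fun t =>
    (t.1.asHomogeneousIdeal.toIdeal.restrictScalars ℂ).comap (Submodule.subtype _)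
  obtain ⟨l, hl⟩ := Submodule.exists_forall_notMem_of_forall_ne_top P fun t htop => by
    refine t.1.not_irrelevant_le fun f hf => ?_
    have hX : ∀ i, (MvPolynomial.X i : MvPolynomial (Fin (N + 1)) ℂ) ∈
        t.1.asHomogeneousIdeal.toIdeal := by
      intro i
      have : (⟨MvPolynomial.X i, MvPolynomial.isHomogeneous_X ℂ i⟩ :
        MvPolynomial.homogeneousSubmodule (Fin (N + 1)) ℂ 1) ∈ P t := htop ▸ Submodule.mem_top
      exact this
    change f ∈ t.1.asHomogeneousIdeal.toIdeal
    rw [MvPolynomial.as_sum f]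
    refine Ideal.sum_mem _ fun m hm => ?_
    by_cases h0 : m = 0
    · exfalso
      subst h0
      have h1 : MvPolynomial.coeff 0 f = 0 := by
        have h2 : GradedRing.proj (MvPolynomial.homogeneousSubmodule (Fin (N + 1)) ℂ) 0 f = 0 := hf
        have h3 : MvPolynomial.homogeneousComponent 0 f = 0 := by
          rw [← h2]
          exact (MvPolynomial.decomposition.decompose'_apply f 0).symm
        rw [MvPolynomial.homogeneousComponent_zero] at h3
        simpa using h3
      exact (MvPolynomial.mem_support_iff.mp hm) h1
    · obtain ⟨i, hi⟩ := Finsupp.ne_iff.mp h0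
      have : (MvPolynomial.X i : MvPolynomial (Fin (N + 1)) ℂ) ∣
          MvPolynomial.monomial m (MvPolynomial.coeff m f) := by
        rw [MvPolynomial.X_dvd_monomial]
        exact Or.inr hi
      exact Ideal.mem_of_dvd _ this (hX i)
  exact ⟨l, l.2, fun t ht => hl ⟨t, ht⟩⟩

/-- Finitely many points of a quasi-affine scheme lie in a common affine open subset. -/
lemma exists_isAffineOpen_of_isQuasiAffine (V : Scheme.{0}) [V.IsQuasiAffine] (T : Set V)
    (hT : T.Finite) : ∃ W : V.Opens, IsAffineOpen W ∧ T ⊆ W := by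
  classical
  obtain ⟨I, hI⟩ := (PrimeSpectrum.isClosed_iff_zeroLocus_ideal (R := Γ(V, ⊤)) _).mp
    V.toSpecΓ.isOpenEmbedding.isOpen_range.isClosed_compl
  obtain ⟨r, hrI, hr⟩ : ∃ r ∈ I, ∀ t ∈ T, r ∉ (V.toSpecΓ t).asIdeal := by
    by_contra! hcon
    have h1 : (I : Set Γ(V, ⊤)) ⊆ ⋃ t ∈ (hT.toFinset : Set V), (V.toSpecΓ t).asIdeal := by
      intro r hr
      obtain ⟨t, ht, hrt⟩ := hcon r hr
      exact Set.mem_biUnion (by simpa using ht) hrt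
    rcases T.eq_empty_or_nonempty with rfl | ⟨t₀, -⟩
    · obtain ⟨t, ht, -⟩ := hcon 0 I.zero_mem
      exact ht
    · obtain ⟨t, -, ht⟩ := (Ideal.subset_union_prime t₀ t₀
        fun t _ _ _ => (V.toSpecΓ t).2).mp h1
      have : V.toSpecΓ t ∈ PrimeSpectrum.zeroLocus (I : Set Γ(V, ⊤)) := ht
      rw [← hI] at this
      exact this ⟨t, rfl⟩
  refine ⟨V.basicOpen r, ?_, fun t ht => ?_⟩
  · have hrU : (PrimeSpectrum.basicOpen r : Set (PrimeSpectrum Γ(V, ⊤))) ⊆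
        Set.range V.toSpecΓ := by
      intro y hy
      by_contra hy'
      have : y ∈ PrimeSpectrum.zeroLocus (I : Set Γ(V, ⊤)) := hI ▸ hy'
      exact hy (this hrI)
    rw [← V.toSpecΓ_preimage_basicOpen, ← Scheme.Hom.isAffineOpen_iff_of_isOpenImmersion V.toSpecΓ]
    have h1 : V.toSpecΓ ''ᵁ V.toSpecΓ ⁻¹ᵁ PrimeSpectrum.basicOpen r =
        PrimeSpectrum.basicOpen r := Opens.ext (Set.image_preimage_eq_of_subset hrU)
    exact (congrArg IsAffineOpen h1).mpr (IsAffineOpen.Spec_basicOpen r)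
  · rw [← V.toSpecΓ_preimage_basicOpen]
    exact hr t ht

section Variety

variable {X : Scheme.{0}} [X.Over SpecC] [hX : IsQuasiProjVariety X]

include hX in
lemma isNoetherian_of_variety : IsNoetherian X := by
  have := hX.locallyOfFiniteType
  have := hX.quasiCompact
  have : CompactSpace X := QuasiCompact.compactSpace_of_compactSpace (X ↘ SpecC)
  have : IsLocallyNoetherian X := LocallyOfFiniteType.isLocallyNoetherian (X ↘ SpecC)
  exact {}

include hX in
lemma jacobsonSpace_of_variety : JacobsonSpace X := by
  have := hX.locallyOfFiniteType
  exact LocallyOfFiniteType.jacobsonSpace (X ↘ SpecC)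

include hX in
/-- Finitely many points of an open subset `U` of a quasi-projective variety lie in a common affine
open subset of `U`. -/
lemma exists_isAffineOpen_of_finite (U : X.Opens) (T : Set X) (hT : T.Finite) (hTU : T ⊆ U) :
    ∃ W : X.Opens, IsAffineOpen W ∧ W ≤ U ∧ T ⊆ W := by
  have := isNoetherian_of_variety (X := X)
  obtain ⟨N, j, hj, -⟩ := hX.exists_immersion
  obtain ⟨l, hl, hlT⟩ := exists_linearForm_forall_mem_basicOpen (j '' T) (hT.image j)
  let D := Proj.basicOpen (MvPolynomial.homogeneousSubmodule (Fin (N + 1)) ℂ) l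
  have hD : IsAffineOpen D := Proj.isAffineOpen_basicOpen _ l hl one_pos
  have : IsAffine D.toScheme := hD
  let V : X.Opens := U ⊓ j ⁻¹ᵁ D
  have hrange : Set.range (V.ι ≫ j) ⊆ Set.range D.ι := by
    rintro _ ⟨v, rfl⟩
    rw [Scheme.Opens.range_ι]
    have : V.ι v ∈ V := v.2
    exact this.2
  have himm : IsImmersion (IsOpenImmersion.lift D.ι (V.ι ≫ j) hrange) := by
    have : IsImmersion (IsOpenImmersion.lift D.ι (V.ι ≫ j) hrange ≫ D.ι) := by
      rw [IsOpenImmersion.lift_fac]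
      infer_instance
    exact IsImmersion.of_comp _ D.ι
  have : CompactSpace V.toScheme :=
    isCompact_iff_compactSpace.mp (NoetherianSpace.isCompact (V : Set X))
  have : V.toScheme.IsQuasiAffine := Scheme.IsQuasiAffine.of_isImmersion
    (IsOpenImmersion.lift D.ι (V.ι ≫ j) hrange)
  have hTV : T ⊆ V := fun t ht => ⟨hTU ht, hlT (j t) ⟨t, ht, rfl⟩⟩
  obtain ⟨W, hW, hWT⟩ := exists_isAffineOpen_of_isQuasiAffine V.toScheme (V.ι ⁻¹' T)
    (hT.preimage V.ι.isOpenEmbedding.injective.injOn)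
  refine ⟨V.ι ''ᵁ W, hW.image_of_isOpenImmersion V.ι, ?_, fun t ht => ?_⟩
  · exact ((V.ι.image_le_opensRange W).trans V.opensRange_ι.le).trans inf_le_left
  · exact ⟨⟨t, hTV ht⟩, hWT ht, rfl⟩

end Variety

/-! ### Classical points -/

section Points

variable {X : Scheme.{0}} [X.Over SpecC]

/-- The point of an affine open subset `W` given by a homomorphism `Γ(X, W) → ℂ`. -/
noncomputable def classicalPoint {W : X.Opens} (hW : IsAffineOpen W) (φ : Γ(X, W) →ₐ[ℂ] ℂ) : X :=
  hW.fromSpec (⟨RingHom.ker φ, RingHom.ker_isPrime φ⟩ : PrimeSpectrum Γ(X, W))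

lemma classicalPoint_mem {W : X.Opens} (hW : IsAffineOpen W) (φ : Γ(X, W) →ₐ[ℂ] ℂ) :
    classicalPoint hW φ ∈ W := fromSpec_mem hW _

lemma classicalPoint_mem_basicOpen {W : X.Opens} (hW : IsAffineOpen W) (φ : Γ(X, W) →ₐ[ℂ] ℂ)
    (s : Γ(X, W)) : classicalPoint hW φ ∈ X.basicOpen s ↔ φ s ≠ 0 :=
  fromSpec_mem_basicOpen hW _ s

lemma classicalPoint_injective {W : X.Opens} (hW : IsAffineOpen W) :
    Function.Injective (classicalPoint hW) := by
  intro φ ψ h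
  have h1 := hW.fromSpec.isOpenEmbedding.injective h
  exact algHom_ext_of_ker_le (congrArg PrimeSpectrum.asIdeal h1).le

variable [hX : IsQuasiProjVariety X]

include hX in
lemma isClosed_classicalPoint {W : X.Opens} (hW : IsAffineOpen W) (φ : Γ(X, W) →ₐ[ℂ] ℂ) :
    IsClosed ({classicalPoint hW φ} : Set X) := by
  have := jacobsonSpace_of_variety (X := X)
  have h1 := hW.fromSpec.isOpenEmbedding.preimage_closedPoints
  have h2 : (⟨RingHom.ker φ, RingHom.ker_isPrime φ⟩ : PrimeSpectrum Γ(X, W)) ∈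
      closedPoints (PrimeSpectrum Γ(X, W)) :=
    (PrimeSpectrum.isClosed_singleton_iff_isMaximal _).mpr (ker_algHom_isMaximal φ)
  exact h1.ge h2

include hX in
lemma exists_classicalPoint_eq {W : X.Opens} (hW : IsAffineOpen W) {x : X} (hx : x ∈ W)
    (hxc : IsClosed ({x} : Set X)) : ∃ φ, classicalPoint hW φ = x := by
  have := hX.locallyOfFiniteType
  have := finiteType_section hW
  have h1 := hW.primeIdealOf_isMaximal_of_isClosed ⟨x, hx⟩ hxc
  obtain ⟨φ, hφ⟩ := exists_algHom_ker_eq (hW.primeIdealOf ⟨x, hx⟩).asIdeal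
  exact ⟨φ, (congrArg hW.fromSpec (PrimeSpectrum.ext hφ)).trans
    (hW.fromSpec_primeIdealOf ⟨x, hx⟩)⟩

end Points

/-! ### Generic points and rational functions -/

section Reduced

variable {X : Scheme.{0}}

lemma exists_genericPoint_specializes (x : X) : ∃ η : genericPoints X, η.1 ⤳ x := by
  obtain ⟨y, hy⟩ := QuasiSober.sober (isIrreducible_irreducibleComponent (x := x))
    isClosed_irreducibleComponent
  exact ⟨⟨y, by
    change closure {y} ∈ irreducibleComponents X
    rw [hy.def]
    exact irreducibleComponent_mem_irreducibleComponents x⟩, hy.specializes mem_irreducibleComponent⟩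

lemma dense_of_forall_genericPoint_mem {U : X.Opens} (h : ∀ η : genericPoints X, η.1 ∈ U) :
    Dense (U : Set X) := by
  intro x
  obtain ⟨η, hη⟩ := exists_genericPoint_specializes x
  exact hη.mem_closed isClosed_closure (subset_closure (h η))

lemma eq_of_specializes_genericPoint (η : genericPoints X) {x : X} (h : x ⤳ η.1) : x = η.1 :=
  (h.antisymm (mem_genericPoints_iff.mp η.2 x h)).eq

lemma Represents.res {U V : X.Opens} (i : V ⟶ U) {s : Γ(X, U)} {f : RatFun X}
    (h : Represents s f) : Represents (X.presheaf.map i.op s) f := fun x hx =>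
  (X.presheaf.germ_res_apply i x.1 hx s).trans (h x (i.le hx))

lemma Represents.add {U : X.Opens} {s t : Γ(X, U)} {f g : RatFun X}
    (hs : Represents s f) (ht : Represents t g) : Represents (s + t) (f + g) := fun x hx => by
  rw [map_add, hs x hx, ht x hx]; rfl

lemma Represents.sum {U : X.Opens} {ι : Type*} (J : Finset ι) {s : ι → Γ(X, U)}
    {f : ι → RatFun X} (h : ∀ j, Represents (s j) (f j)) :
    Represents (∑ j ∈ J, s j) (∑ j ∈ J, f j) := by
  classical
  induction J using Finset.induction_on with
  | empty => exact fun x hx => by simp only [Finset.sum_empty, map_zero]; rfl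
  | insert a J ha ih =>
    rw [Finset.sum_insert ha, Finset.sum_insert ha]
    exact (h a).add ih

lemma Represents.smul [X.Over SpecC] {U : X.Opens} {s : Γ(X, U)} {f : RatFun X}
    (h : Represents s f) (c : ℂ) : Represents (c • s) (c • f) := fun x hx => by
  rw [Algebra.smul_def, Algebra.smul_def, map_mul, h x hx, algebraMap_section,
    ← algebraMap_ratFun c x hx]
  rfl

variable [IsReduced X]

/-- On a reduced scheme a section that vanishes at all generic points is zero. -/
lemma eq_zero_of_represents_zero {U : X.Opens} {s : Γ(X, U)} (h : Represents s 0) : s = 0 := by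
  refine eq_zero_of_basicOpen_eq_bot s ?_
  by_contra hne
  obtain ⟨x, hx⟩ : ∃ x : X, x ∈ X.basicOpen s := by
    by_contra! hne'
    exact hne (Opens.ext (Set.eq_empty_of_forall_notMem hne'))
  obtain ⟨η, hη⟩ := exists_genericPoint_specializes x
  have h1 : η.1 ∈ X.basicOpen s := hη.mem_open (X.basicOpen s).isOpen hx
  have hηU : η.1 ∈ U := X.basicOpen_le s h1
  rw [X.mem_basicOpen s η.1 hηU, h η hηU] at h1
  exact not_isUnit_zero h1

/-- On a reduced scheme a rational function has at most one representative on an open set. -/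
lemma Represents.unique {U : X.Opens} {s t : Γ(X, U)} {f : RatFun X}
    (hs : Represents s f) (ht : Represents t f) : s = t := by
  rw [← sub_eq_zero]
  refine eq_zero_of_represents_zero fun x hx => ?_
  rw [map_sub, hs x hx, ht x hx, sub_self]
  rfl

lemma Represents.vanishesAt_iff {U : X.Opens} {s : Γ(X, U)} {f : RatFun X}
    (h : Represents s f) {x : X} (hx : x ∈ U) : VanishesAt f x ↔ x ∉ X.basicOpen s := by
  refine ⟨?_, fun hs => ⟨U, hx, s, h, hs⟩⟩
  rintro ⟨V, hxV, t, ht, hxt⟩ hxs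
  have h1 := (h.res (homOfLE (inf_le_left : U ⊓ V ≤ U))).unique
    (ht.res (homOfLE (inf_le_right : U ⊓ V ≤ V)))
  have h2 : x ∈ X.basicOpen (X.presheaf.map (homOfLE (inf_le_left : U ⊓ V ≤ U)).op s) := by
    rw [X.basicOpen_res]
    exact ⟨⟨hx, hxV⟩, hxs⟩
  rw [h1, X.basicOpen_res] at h2
  exact hxt h2.2

/-- Local representatives of a rational function glue. -/
lemma exists_represents_of_forall_isRegularAt {U : X.Opens} {f : RatFun X}
    (h : ∀ x ∈ U, IsRegularAt f x) : ∃ s : Γ(X, U), Represents s f := by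
  have h' : ∀ x : U, ∃ (V : X.Opens) (_ : x.1 ∈ V) (_ : V ≤ U) (s : Γ(X, V)),
      Represents s f := by
    intro x
    obtain ⟨V, hxV, s, hs⟩ := h x.1 x.2
    exact ⟨V ⊓ U, ⟨hxV, x.2⟩, inf_le_right, _, hs.res (homOfLE inf_le_left)⟩
  choose V hxV hVU s hs using h'
  obtain ⟨t, ht, -⟩ := X.sheaf.existsUnique_gluing' V U (fun x => homOfLE (hVU x))
    (fun x hx => Opens.mem_iSup.mpr ⟨⟨x, hx⟩, hxV ⟨x, hx⟩⟩) s
    (fun x y => ((hs x).res (Opens.infLELeft (V x) (V y))).unique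
      ((hs y).res (Opens.infLERight (V x) (V y))))
  refine ⟨t, fun η hη => ?_⟩
  have h1 := hs ⟨η.1, hη⟩ η (hxV _)
  have h2 : X.presheaf.map (homOfLE (hVU ⟨η.1, hη⟩)).op t = s ⟨η.1, hη⟩ := ht _
  rw [← h1, ← h2]
  exact (X.presheaf.germ_res_apply _ η.1 _ t).symm

lemma VanishesAt.genericPoint_eq_zero {f : RatFun X} {η : genericPoints X}
    (h : VanishesAt f η.1) : f η = 0 := by
  obtain ⟨U, hU, s, hs, hη⟩ := h
  rw [X.mem_basicOpen s η.1 hU, hs η hU] at hη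
  by_contra h0
  let := (isField_stalk_of_closure_mem_irreducibleComponents X η.1 η.2).toField
  exact hη (IsUnit.mk0 _ h0)

variable [IsNoetherian X]

lemma finite_genericPoints (X : Scheme.{0}) [IsNoetherian X] : (genericPoints X).Finite := by
  refine Set.Finite.of_finite_image (f := fun x : X => closure ({x} : Set X))
    ((NoetherianSpace.finite_irreducibleComponents (α := X)).subset ?_) ?_
  · rintro _ ⟨x, hx, rfl⟩
    exact hx
  · intro x _ y _ h
    exact (inseparable_iff_closure_eq.mpr h).eq

omit [IsReduced X] in
/-- A rational function is regular near every generic point. -/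
lemma exists_represents_genericPoint (f : RatFun X) (η : genericPoints X) :
    ∃ (V : X.Opens) (_ : η.1 ∈ V) (s : Γ(X, V)), Represents s f := by
  obtain ⟨U, hU, s, hs⟩ := X.presheaf.exists_germ_eq (f η)
  -- The part of a neighbourhood of `η` that lies on no other irreducible component.
  let C : Set X := ⋃ ξ ∈ genericPoints X \ {η.1}, closure {ξ}
  have hC : IsClosed C := ((finite_genericPoints X).subset Set.sdiff_subset).isClosed_biUnion
    fun _ _ => isClosed_closure
  let V : X.Opens := U ⊓ ⟨Cᶜ, hC.isOpen_compl⟩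
  have hη : η.1 ∈ V := by
    refine ⟨hU, fun hηC => ?_⟩
    obtain ⟨ξ, hξ, hηξ⟩ := Set.mem_iUnion₂.mp hηC
    exact hξ.2 (eq_of_specializes_genericPoint η (specializes_iff_mem_closure.mpr hηξ))
  refine ⟨V, hη, X.presheaf.map (homOfLE inf_le_left).op s, fun ξ hξ => ?_⟩
  have : ξ = η := by
    by_contra hne
    exact hξ.2 (Set.mem_biUnion ⟨ξ.2, fun h => hne (Subtype.ext h)⟩ (subset_closure rfl))
  subst this
  rw [← hs]
  exact X.presheaf.germ_res_apply _ ξ.1 _ s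

end Reduced

/-! ### Generic systems on good open sets -/

section Good

variable {X : Scheme.{0}} [X.Over SpecC]

/-- An open set `U` is good for `L₁, …, Lₙ` if it is dense, all functions of the `Lᵢ` are regular
on `U`, and no `Lᵢ` has a base point in `U`. -/
structure IsGood {n : ℕ} (L : Fin n → Submodule ℂ (RatFun X)) (U : X.Opens) : Prop where
  dense : Dense (U : Set X)
  regular : ∀ i, ∀ f ∈ L i, ∃ s : Γ(X, U), Represents s f
  base : ∀ i, ∀ x ∈ U, ∃ f ∈ L i, ¬ VanishesAt f x

/-- The classical points of `U` at which all the rational functions `f i` vanish. -/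
def zeros {n : ℕ} (U : Set X) (f : Fin n → RatFun X) : Set X :=
  {x | x ∈ U ∧ IsClosed ({x} : Set X) ∧ ∀ i, VanishesAt (f i) x}

/-- The system of linear combinations of the functions `g i j` with coefficients `c (i, j)`. -/
noncomputable def combination {n : ℕ} {ι : Type} [Fintype ι] (g : Fin n → ι → RatFun X)
    (c : Fin n × ι → ℂ) (i : Fin n) : RatFun X :=
  ∑ j, c (i, j) • g i j

lemma IsGood.mono {n : ℕ} {L : Fin n → Submodule ℂ (RatFun X)} {U V : X.Opens} (h : IsGood L U)
    (hVU : V ≤ U) (hV : Dense (V : Set X)) : IsGood L V where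
  dense := hV
  regular i f hf := let ⟨_, hs⟩ := h.regular i f hf; ⟨_, hs.res (homOfLE hVU)⟩
  base i x hx := h.base i x (hVU hx)

/-- Finite families of generators of the `Lᵢ` with a common index type: the disjoint union of the
index types of the individual families, where the families are extended by zero. -/
lemma exists_generators {n : ℕ} (L : Fin n → Submodule ℂ (RatFun X))
    (hL : ∀ i, FiniteDimensional ℂ (L i)) : ∃ (ι : Type) (_ : Fintype ι)
      (g : Fin n → ι → RatFun X), ∀ i, Submodule.span ℂ (Set.range (g i)) = L i := by
  have h : ∀ i, ∃ (m : ℕ) (s : Fin m → RatFun X), Submodule.span ℂ (Set.range s) = L i := fun i =>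
    Submodule.fg_iff_exists_fin_generating_family.mp (Module.Finite.iff_fg.mp (hL i))
  choose m s hs using h
  refine ⟨Σ i, Fin (m i), inferInstance, fun i p => if h : p.1 = i then s i (h ▸ p.2) else 0,
    fun i => ?_⟩
  rw [← hs i]
  refine le_antisymm (Submodule.span_le.mpr ?_) (Submodule.span_le.mpr ?_)
  · rintro _ ⟨⟨k, j⟩, rfl⟩
    by_cases h : k = i
    · subst h
      simpa using Submodule.subset_span (Set.mem_range_self j)
    · simp [h]
  · rintro _ ⟨j, rfl⟩
    refine Submodule.subset_span ⟨⟨i, j⟩, ?_⟩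
    simp

section Generators

variable {n : ℕ} {L : Fin n → Submodule ℂ (RatFun X)} {ι : Type} [Fintype ι]
  {g : Fin n → ι → RatFun X} (hg : ∀ i, Submodule.span ℂ (Set.range (g i)) = L i)

include hg in
lemma combination_mem (c : Fin n × ι → ℂ) (i : Fin n) : combination g c i ∈ L i := by
  rw [← hg i]
  exact Submodule.sum_mem _ fun j _ =>
    Submodule.smul_mem _ _ (Submodule.subset_span (Set.mem_range_self j))

include hg in
lemma exists_combination_eq {f : Fin n → RatFun X} (hf : ∀ i, f i ∈ L i) :
    ∃ c, combination g c = f := by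
  have h : ∀ i, ∃ d : ι → ℂ, ∑ j, d j • g i j = f i := fun i => by
    have := hf i
    rw [← hg i] at this
    exact (Submodule.mem_span_range_iff_exists_fun ℂ).mp this
  choose d hd using h
  exact ⟨fun p => d p.1 p.2, funext hd⟩

omit hg in
lemma represents_combination {U : X.Opens} {s : Fin n → ι → Γ(X, U)}
    (hs : ∀ i j, Represents (s i j) (g i j)) (c : Fin n × ι → ℂ) (i : Fin n) :
    Represents (∑ j, c (i, j) • s i j) (combination g c i) :=
  Represents.sum _ fun j => (hs i j).smul (c (i, j))

include hg in
omit [Fintype ι] in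
lemma IsGood.exists_represents {U : X.Opens} (hU : IsGood L U) :
    ∃ s : Fin n → ι → Γ(X, U), ∀ i j, Represents (s i j) (g i j) := by
  have h : ∀ i j, ∃ s : Γ(X, U), Represents s (g i j) := fun i j =>
    hU.regular i _ (hg i ▸ Submodule.subset_span (Set.mem_range_self j))
  choose s hs using h
  exact ⟨s, hs⟩

variable [hX : IsQuasiProjVariety X]

include hX in
/-- On an affine open set the zeros of a system are the solutions of the corresponding system of
equations in the coordinate ring. -/
lemma zeros_combination_eq_image {W : X.Opens} (hW : IsAffineOpen W) {s : Fin n → ι → Γ(X, W)}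
    (hs : ∀ i j, Represents (s i j) (g i j)) (c : Fin n × ι → ℂ) :
    zeros W (combination g c) = classicalPoint hW '' solutions s c := by
  have := hX.isReduced
  have hiff : ∀ φ : Γ(X, W) →ₐ[ℂ] ℂ, φ ∈ solutions s c ↔
      ∀ i, VanishesAt (combination g c i) (classicalPoint hW φ) := by
    intro φ
    refine forall_congr' fun i => ?_
    rw [(represents_combination hs c i).vanishesAt_iff (classicalPoint_mem hW φ),
      classicalPoint_mem_basicOpen, not_not, map_sum]
    simp only [map_smul, smul_eq_mul]
  ext x
  constructor
  · rintro ⟨hxW, hxc, hx⟩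
    obtain ⟨φ, rfl⟩ := exists_classicalPoint_eq hW hxW hxc
    exact ⟨φ, (hiff φ).mpr hx, rfl⟩
  · rintro ⟨φ, hφ, rfl⟩
    exact ⟨classicalPoint_mem hW φ, isClosed_classicalPoint hW φ, (hiff φ).mp hφ⟩

omit hX in
lemma map_constHom {U V : X.Opens} (hVU : V ≤ U) (c : ℂ) :
    X.presheaf.map (homOfLE hVU).op (constHom U c) = constHom V c := by
  have := (X ↘ SpecC).appLE_map (U := ⊤) (V := U) (V' := V) le_top (homOfLE hVU).op
  simp only [constHom, ← this]
  rfl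

omit hX in
/-- The restriction of the function `∑ j, d (i, j) • s i j` to an open set on which it has no zeros
is invertible. -/
lemma isUnit_sum_algebraMap_mul {U W : X.Opens} {s : Fin n → ι → Γ(X, U)} (hWU : W ≤ U)
    (d : Fin n × ι → ℂ) (i : Fin n) (hd : W ≤ X.basicOpen (∑ j, d (i, j) • s i j)) :
    IsUnit (∑ j, algebraMap ℂ Γ(X, W) (d (i, j)) * X.presheaf.map (homOfLE hWU).op (s i j)) := by
  have h1 : ∑ j, algebraMap ℂ Γ(X, W) (d (i, j)) * X.presheaf.map (homOfLE hWU).op (s i j) =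
      X.presheaf.map (homOfLE hWU).op (∑ j, d (i, j) • s i j) := by
    rw [map_sum]
    refine Finset.sum_congr rfl fun j _ => ?_
    rw [Algebra.smul_def, map_mul, algebraMap_section, algebraMap_section, map_constHom]
  have h2 := (RingedSpace.isUnit_res_basicOpen X.toRingedSpace (∑ j, d (i, j) • s i j)).map
    (X.presheaf.map (homOfLE hd).op).hom
  rw [h1]
  convert! h2 using 1
  exact ConcreteCategory.congr_hom
    (X.presheaf.map_comp (homOfLE (X.basicOpen_le _)).op (homOfLE hd).op) _

include hX hg in
/-- Finitely many points of a good open set have an affine neighbourhood on which every `Lᵢ`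
contains an invertible function. -/
lemma IsGood.exists_isAffineOpen {U : X.Opens} (hU : IsGood L U) {s : Fin n → ι → Γ(X, U)}
    (hs : ∀ i j, Represents (s i j) (g i j)) (T : Set X) (hT : T.Finite) (hTU : T ⊆ U) :
    ∃ (W : X.Opens) (_ : IsAffineOpen W) (hWU : W ≤ U) (_ : T ⊆ W) (d : Fin n × ι → ℂ), ∀ i,
      IsUnit (∑ j, algebraMap ℂ Γ(X, W) (d (i, j)) *
        X.presheaf.map (homOfLE hWU).op (s i j)) := by
  have := hX.isReduced
  have := hT.to_subtype
  have h : ∀ i, ∃ d : ι → ℂ, ∀ t ∈ T, t ∈ X.basicOpen (∑ j, d j • s i j) := by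
    intro i
    -- The combinations vanishing at `t` form a proper subspace; finitely many of these do not cover.
    let P : T → Submodule ℂ (ι → ℂ) := fun t =>
      ((RingHom.ker (X.evaluation U t.1 (hTU t.2)).hom).restrictScalars ℂ).comap
        (Fintype.linearCombination ℂ (s i))
    have hP : ∀ (t : T) (d : ι → ℂ), d ∈ P t ↔ t.1 ∉ X.basicOpen (∑ j, d j • s i j) := fun t d =>
      X.evaluation_eq_zero_iff_notMem_basicOpen t.1 (hTU t.2) _
    obtain ⟨d, hd⟩ := Submodule.exists_forall_notMem_of_forall_ne_top P fun t htop => by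
      obtain ⟨f, hf, hft⟩ := hU.base i t.1 (hTU t.2)
      rw [← hg i] at hf
      obtain ⟨d, rfl⟩ := (Submodule.mem_span_range_iff_exists_fun ℂ).mp hf
      refine hft (((Represents.sum _ fun j => (hs i j).smul (d j)).vanishesAt_iff
        (hTU t.2)).mpr ((hP t d).mp (htop ▸ Submodule.mem_top)))
    exact ⟨d, fun t ht => not_not.mp (mt (hP ⟨t, ht⟩ d).mpr (hd ⟨t, ht⟩))⟩
  -- An affine neighbourhood of the points inside the locus where the chosen functions do not vanish.
  choose d hd using h
  let U' : X.Opens := U ⊓ Finset.univ.inf fun i => X.basicOpen (∑ j, d i j • s i j)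
  have hU' : ∀ i, U' ≤ X.basicOpen (∑ j, d i j • s i j) := fun i =>
    inf_le_right.trans (Finset.inf_le (Finset.mem_univ i))
  obtain ⟨W, hW, hWU', hTW⟩ := exists_isAffineOpen_of_finite U' T hT fun t ht => by
    refine ⟨hTU ht, ?_⟩
    rw [Opens.coe_finset_inf]
    simpa using fun i => hd i t ht
  exact ⟨W, hW, hWU'.trans inf_le_left, hTW, fun p => d p.1 p.2, fun i =>
    isUnit_sum_algebraMap_mul _ (fun p => d p.1 p.2) i (hWU'.trans (hU' i))⟩

variable (hdim : IsPureDim X n)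

include hX hg hdim in
/-- The number of zeros of a generic system is bounded. -/
lemma IsGood.exists_bound_zeros {U : X.Opens} (hU : IsGood L U) :
    ∃ D : ℕ, Generic fun c => (zeros (U : Set X) (combination g c)).encard ≤ D := by
  have := isNoetherian_of_variety (X := X)
  have := hX.locallyOfFiniteType
  obtain ⟨s, hs⟩ := hU.exists_represents hg
  refine (NoetherianSpace.isCompact (U : Set X)).induction_on
    (p := fun T => ∃ D : ℕ, Generic fun c => (zeros T (combination g c)).encard ≤ D) ?_ ?_ ?_ ?_
  · exact ⟨0, Generic.of_forall fun c => by
      rw [Set.eq_empty_of_forall_notMem fun x (hx : x ∈ zeros ∅ _) => hx.1]; simp⟩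
  · rintro T T' hTT' ⟨D, hD⟩
    exact ⟨D, hD.mono fun c hc => (Set.encard_le_encard
      fun x (hx : x ∈ zeros T _) => (⟨hTT' hx.1, hx.2⟩ : x ∈ zeros T' _)).trans hc⟩
  · rintro T T' ⟨D, hD⟩ ⟨D', hD'⟩
    refine ⟨D + D', (hD.and hD').mono fun c hc => ?_⟩
    refine (Set.encard_le_encard (t := zeros T (combination g c) ∪ zeros T' (combination g c))
      ?_).trans ((Set.encard_union_le _ _).trans ?_)
    · rintro x ⟨hx | hx, hx'⟩
      exacts [Or.inl ⟨hx, hx'⟩, Or.inr ⟨hx, hx'⟩]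
    · rw [Nat.cast_add]
      exact add_le_add hc.1 hc.2
  · intro x hx
    obtain ⟨W, hW, hWU, hxW, d, hd⟩ := hU.exists_isAffineOpen hg hs {x} (Set.finite_singleton x)
      (Set.singleton_subset_iff.mpr hx)
    have := finiteType_section hW
    refine ⟨W, mem_nhdsWithin_of_mem_nhds (W.isOpen.mem_nhds (hxW rfl)), ?_⟩
    obtain ⟨D, hD⟩ := exists_bound_solutions (trdeg_quotient_minimalPrimes hdim hW)
      (fun i j => X.presheaf.map (homOfLE hWU).op (s i j)) d hd
    refine ⟨D, hD.mono fun c hc => ?_⟩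
    rw [zeros_combination_eq_image hW fun i j => (hs i j).res (homOfLE hWU)]
    exact (Set.encard_image_le _ _).trans hc

include hX hg hdim in
/-- A system with finitely many zeros in `U` has at most as many zeros as a generic system has
in a dense open subset `V` of `U`. -/
lemma IsGood.generic_encard_zeros_le {U V : X.Opens} (hU : IsGood L U)
    (hV : Dense (V : Set X)) (c₀ : Fin n × ι → ℂ)
    (hfin : (zeros (U : Set X) (combination g c₀)).Finite) :
    Generic fun c => (zeros (U : Set X) (combination g c₀)).encard ≤
      (zeros (V : Set X) (combination g c)).encard := by
  have := hX.locallyOfFiniteType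
  obtain ⟨s, hs⟩ := hU.exists_represents hg
  obtain ⟨W, hW, hWU, hTW, d, hd⟩ := hU.exists_isAffineOpen hg hs _ hfin fun x hx => hx.1
  have := finiteType_section hW
  have hzW : zeros (W : Set X) (combination g c₀) = zeros (U : Set X) (combination g c₀) :=
    Set.Subset.antisymm (fun x hx => ⟨hWU hx.1, hx.2⟩) fun x hx => ⟨hTW hx, hx.2⟩
  have hzero := zeros_combination_eq_image hW fun i j => (hs i j).res (homOfLE hWU)
  have hinj := classicalPoint_injective hW
  -- The ideal of the complement of `V` in `W`.
  obtain ⟨I, hI⟩ := (PrimeSpectrum.isClosed_iff_zeroLocus_ideal (R := Γ(X, W)) _).mp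
    (V.isOpen.preimage hW.fromSpec.continuous).isClosed_compl
  have hI' : ∀ y : PrimeSpectrum Γ(X, W), ¬ I ≤ y.asIdeal ↔ hW.fromSpec y ∈ V := by
    intro y
    have : y ∈ (hW.fromSpec ⁻¹' (V : Set X))ᶜ ↔ I ≤ y.asIdeal := by rw [hI]; rfl
    rw [← this]
    exact not_not
  rw [← hzW, hzero] at hfin
  rw [← hzW, hzero, hinj.encard_image]
  refine (generic_encard_solutions_le (trdeg_quotient_minimalPrimes hdim hW) _ d hd c₀
    (hfin.of_finite_image hinj.injOn) I fun p hp => ?_).mono fun c hc => ?_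
  · refine (hI' ⟨p, hp.1.1⟩).mpr (genericPoint_mem_of_dense hV ⟨_, ?_⟩)
    exact (fromSpec_mem_genericPoints_iff hW _).mpr hp
  · refine hc.trans ?_
    rw [← hinj.encard_image]
    refine Set.encard_le_encard ?_
    rintro _ ⟨φ, ⟨hφ, hφI⟩, rfl⟩
    have h1 : classicalPoint hW φ ∈ zeros (W : Set X) (combination g c) :=
      (hzero c).ge ⟨φ, hφ, rfl⟩
    exact ⟨(hI' ⟨RingHom.ker φ, RingHom.ker_isPrime φ⟩).mp hφI, h1.2⟩

end Generators

/-- The numbers of zeros in `U` of the systems with finitely many zeros in `U`. -/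
def zeroCounts {n : ℕ} (L : Fin n → Submodule ℂ (RatFun X)) (U : X.Opens) : Set ℕ :=
  {k | ∃ f : Fin n → RatFun X, (∀ i, f i ∈ L i) ∧ (zeros (U : Set X) f).Finite ∧
    (zeros (U : Set X) f).ncard = k}

variable [hX : IsQuasiProjVariety X] {n : ℕ} {L : Fin n → Submodule ℂ (RatFun X)}

include hX in
/-- The number of roots of systems of regular functions on a good open set, in terms of rational
functions. -/
lemma IsGood.rootCounts_eq {U : X.Opens} (hU : IsGood L U) :
    rootCounts U (fun i => restrict (L i) U) = zeroCounts L U := by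
  have := hX.isReduced
  have key : ∀ (s : Fin n → Γ(X, U)) (f : Fin n → RatFun X), (∀ i, Represents (s i) (f i)) →
      roots U s = zeros (U : Set X) f := by
    intro s f h
    ext x
    refine and_congr_right fun hx => and_congr_right fun _ => forall_congr' fun i => ?_
    exact ((h i).vanishesAt_iff hx).symm
  ext k
  constructor
  · rintro ⟨s, hs, hfin, hk⟩
    choose f hf hsf using hs
    rw [key s f hsf] at hfin hk
    exact ⟨f, hf, hfin, hk⟩
  · rintro ⟨f, hf, hfin, hk⟩
    choose s hs using fun i => hU.regular i (f i) (hf i)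
    rw [← key s f hs] at hfin hk
    exact ⟨s, fun i => ⟨f i, hf i, hs i⟩, hfin, hk⟩

include hX in
/-- The maximal number of zeros is attained, and the same for all dense open subsets. -/
lemma IsGood.exists_isGreatest (hdim : IsPureDim X n) (hL : ∀ i, FiniteDimensional ℂ (L i))
    {U : X.Opens} (hU : IsGood L U) :
    ∃ m, IsGreatest (zeroCounts L U) m ∧
      ∀ V ≤ U, Dense (V : Set X) → IsGreatest (zeroCounts L V) m := by
  obtain ⟨ι, _, g, hg⟩ := exists_generators L hL
  obtain ⟨D, hD⟩ := hU.exists_bound_zeros hg hdim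
  have hsub : ∀ V ≤ U, ∀ f : Fin n → RatFun X,
      zeros (V : Set X) f ⊆ zeros (U : Set X) f := fun V hVU f x hx => ⟨hVU hx.1, hx.2⟩
  have hfin : ∀ c, (zeros (U : Set X) (combination g c)).encard ≤ D →
      (zeros (U : Set X) (combination g c)).Finite := fun c hc =>
    Set.encard_lt_top_iff.mp (hc.trans_lt (ENat.natCast_lt_top D))
  -- The counts on `V` are dominated by the counts on any dense open subset `V'` of `V`.
  have key : ∀ V ≤ U, Dense (V : Set X) → ∀ V' ≤ V, Dense (V' : Set X) →
      ∀ k ∈ zeroCounts L V, ∃ k' ∈ zeroCounts L V', k ≤ k' ∧ k' ≤ D := by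
    rintro V hVU hV V' hV'V hV' k ⟨f, hf, hfinf, rfl⟩
    obtain ⟨c₀, rfl⟩ := exists_combination_eq hg hf
    obtain ⟨c, hc1, hc2⟩ := (hD.and ((hU.mono hVU hV).generic_encard_zeros_le hg hdim hV'
      c₀ hfinf)).nonempty
    have hfin' := (hfin c hc1).subset (hsub V' (hV'V.trans hVU) _)
    refine ⟨_, ⟨combination g c, combination_mem hg c, hfin', rfl⟩, ?_, ?_⟩
    · rw [← hfinf.cast_ncard_eq, ← hfin'.cast_ncard_eq] at hc2
      exact_mod_cast hc2
    · have := (Set.encard_le_encard (hsub V' (hV'V.trans hVU) (combination g c))).trans hc1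
      rw [← hfin'.cast_ncard_eq] at this
      exact_mod_cast this
  have hne : (zeroCounts L U).Nonempty := by
    obtain ⟨c, hc⟩ := hD.nonempty
    exact ⟨_, combination g c, combination_mem hg c, hfin c hc, rfl⟩
  have hbdd : BddAbove (zeroCounts L U) := ⟨D, fun k hk => by
    obtain ⟨k', -, h1, h2⟩ := key U le_rfl hU.dense U le_rfl hU.dense k hk
    exact h1.trans h2⟩
  have hmax : IsGreatest (zeroCounts L U) (sSup (zeroCounts L U)) :=
    ⟨Nat.sSup_mem hne hbdd, fun k hk => le_csSup hbdd hk⟩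
  -- The counts on `V` do not exceed those on `U`, as a generic system has finitely many zeros in `U`.
  have hle : ∀ V ≤ U, Dense (V : Set X) → ∀ k ∈ zeroCounts L V, k ≤ sSup (zeroCounts L U) := by
    rintro V hVU hV k ⟨f, hf, hfinf, rfl⟩
    obtain ⟨c₀, rfl⟩ := exists_combination_eq hg hf
    obtain ⟨c, hc1, hc2⟩ := (hD.and ((hU.mono hVU hV).generic_encard_zeros_le hg hdim hV
      c₀ hfinf)).nonempty
    have h3 := hc2.trans (Set.encard_le_encard (hsub V hVU (combination g c)))
    rw [← hfinf.cast_ncard_eq, ← (hfin c hc1).cast_ncard_eq] at h3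
    exact (Nat.cast_le.mp h3).trans
      (le_csSup hbdd ⟨combination g c, combination_mem hg c, hfin c hc1, rfl⟩)
  refine ⟨_, hmax, fun V hVU hV => ⟨?_, hle V hVU hV⟩⟩
  obtain ⟨k', hk', h1, -⟩ := key U le_rfl hU.dense V hVU hV _ hmax.1
  rwa [le_antisymm h1 (hle V hVU hV k' hk')]

end Good

/-- The maximal numbers of zeros on two good open sets agree with that on their intersection. -/
lemma IsGood.sSup_zeroCounts_eq {X : Scheme.{0}} [X.Over SpecC] [IsQuasiProjVariety X] {n : ℕ}
    {L : Fin n → Submodule ℂ (RatFun X)} (hdim : IsPureDim X n)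
    (hL : ∀ i, FiniteDimensional ℂ (L i)) {U V : X.Opens} (hU : IsGood L U) (hV : IsGood L V) :
    sSup (zeroCounts L U) = sSup (zeroCounts L V) := by
  have hUV : Dense ((U ⊓ V : X.Opens) : Set X) := hU.dense.inter_of_isOpen_left hV.dense U.isOpen
  obtain ⟨m, hm, hm'⟩ := hU.exists_isGreatest hdim hL
  obtain ⟨k, hk, hk'⟩ := hV.exists_isGreatest hdim hL
  rw [hm.csSup_eq, hk.csSup_eq,
    (hm' (U ⊓ V) inf_le_left hUV).unique (hk' (U ⊓ V) inf_le_right hUV)]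

/-! ### Rational functions and open immersions -/

section OpenImmersion

variable {S X : Scheme.{0}} (k : S ⟶ X) [IsOpenImmersion k]

/-- The restriction of a rational function along an open immersion. -/
noncomputable def openPullback (f : RatFun X) : RatFun S := fun η =>
  k.stalkMap η.1 (f ⟨k η.1, (map_mem_genericPoints_iff k η.1).mpr η.2⟩)

variable {k}

lemma Represents.openPullback {U : X.Opens} {s : Γ(X, U)} {f : RatFun X} (h : Represents s f) :
    Represents (k.app U s) (openPullback k f) := fun η hη => by
  rw [← Scheme.Hom.germ_stalkMap_apply k U η.1 hη s]
  exact congrArg (k.stalkMap η.1) (h ⟨k η.1, _⟩ hη)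

/-- A representative of the restriction of `f` to the open subscheme `S`, considered as a section on
an open subset of `X`, represents `f`. -/
lemma exists_represents_of_openPullback {A : S.Opens} {t : Γ(S, A)} {f : RatFun X}
    (h : Represents t (RatIndex.openPullback k f)) : ∃ s : Γ(X, k ''ᵁ A), Represents s f ∧
      S.presheaf.map (eqToHom (k.preimage_image_eq A)).op t = k.app (k ''ᵁ A) s := by
  refine ⟨(k.appIso A).inv t, ?_, ?_⟩
  · rintro ⟨x, hη⟩ hx
    obtain ⟨p, hp, rfl⟩ : ∃ p ∈ A, k p = x := hx
    have hp' : p ∈ genericPoints S := (map_mem_genericPoints_iff k p).mp hη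
    have hinj : Function.Injective (k.stalkMap p) :=
      (ConcreteCategory.bijective_of_isIso (k.stalkMap p)).1
    apply hinj
    refine Eq.trans ?_ (h ⟨p, hp'⟩ hp)
    erw [Scheme.Hom.germ_stalkMap_apply k (k ''ᵁ A) p _ ((k.appIso A).inv t)]
    have := ConcreteCategory.congr_hom (k.appIso_inv_app A) t
    erw [this]
    exact S.presheaf.germ_res_apply (eqToHom (k.preimage_image_eq A)) p _ t
  · exact (ConcreteCategory.congr_hom (k.appIso_inv_app A) t).symm

lemma isRegularAt_openPullback_iff {f : RatFun X} {p : S} :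
    IsRegularAt (openPullback k f) p ↔ IsRegularAt f (k p) := by
  constructor
  · rintro ⟨A, hp, t, ht⟩
    obtain ⟨s, hs, -⟩ := exists_represents_of_openPullback ht
    exact ⟨k ''ᵁ A, ⟨p, hp, rfl⟩, s, hs⟩
  · rintro ⟨U, hp, s, hs⟩
    exact ⟨k ⁻¹ᵁ U, hp, _, hs.openPullback⟩

lemma vanishesAt_openPullback_iff {f : RatFun X} {p : S} :
    VanishesAt (openPullback k f) p ↔ VanishesAt f (k p) := by
  constructor
  · rintro ⟨A, hp, t, ht, hpt⟩
    obtain ⟨s, hs, hst⟩ := exists_represents_of_openPullback ht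
    refine ⟨k ''ᵁ A, ⟨p, hp, rfl⟩, s, hs, fun h => hpt ?_⟩
    have h1 : p ∈ k ⁻¹ᵁ X.basicOpen s := h
    rw [Scheme.preimage_basicOpen, ← hst, S.basicOpen_res] at h1
    exact h1.2
  · rintro ⟨U, hp, s, hs, hps⟩
    refine ⟨k ⁻¹ᵁ U, hp, _, hs.openPullback, ?_⟩
    rw [← Scheme.preimage_basicOpen]
    exact hps

lemma zeros_image [JacobsonSpace X] {n : ℕ} (A : Set S) (f : Fin n → RatFun X) :
    zeros (k '' A) f = k '' zeros A fun i => openPullback k (f i) := by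
  have hcl : ∀ p : S, IsClosed ({k p} : Set X) ↔ IsClosed ({p} : Set S) := fun p =>
    Set.ext_iff.mp k.isOpenEmbedding.preimage_closedPoints p
  ext x
  constructor
  · rintro ⟨⟨p, hp, rfl⟩, hc, hv⟩
    exact ⟨p, ⟨hp, (hcl p).mp hc, fun i => vanishesAt_openPullback_iff.mpr (hv i)⟩, rfl⟩
  · rintro ⟨p, ⟨hp, hc, hv⟩, rfl⟩
    exact ⟨⟨p, hp, rfl⟩, (hcl p).mpr hc, fun i => vanishesAt_openPullback_iff.mp (hv i)⟩

end OpenImmersion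

/-! ### Birational isomorphisms -/

section Birational

variable {X Y : Scheme.{0}} [X.Over SpecC] [Y.Over SpecC] [hX : IsQuasiProjVariety X]
  (τ : X.PartialIso Y) (hτ : τ.IsOver (X ↘ SpecC) (Y ↘ SpecC))

/-- The pull-back of `f` along a birational isomorphism and `f` itself have the same restriction to
the common open subscheme. -/
lemma openPullback_ratPullback (f : RatFun Y) :
    openPullback τ.source.ι (ratPullback τ hτ f) = openPullback (toHom τ) f := by
  funext p
  let x : genericPoints X := ⟨τ.source.ι p.1, (map_mem_genericPoints_iff _ _).mpr p.2⟩
  change τ.source.ι.stalkMap (srcPt τ x) (inv (τ.source.ι.stalkMap (srcPt τ x))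
    ((toHom τ).stalkMap (srcPt τ x) (f (mapGeneric τ x)))) = _
  exact ConcreteCategory.congr_hom (IsIso.inv_hom_id (τ.source.ι.stalkMap (srcPt τ x))) _

omit [Y.Over SpecC] in
lemma stalkPullback_injective (x : genericPoints X) : Function.Injective (stalkPullback τ x) :=
  (ConcreteCategory.bijective_of_isIso
    ((toHom τ).stalkMap (srcPt τ x) ≫ inv (τ.source.ι.stalkMap (srcPt τ x)))).1

lemma map_ratPullback_mem_Krat {L : Submodule ℂ (RatFun Y)} (hL : L ∈ Krat Y) :
    L.map (ratPullback τ hτ).toLinearMap ∈ Krat X := by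
  have := hL.1
  refine ⟨inferInstance, fun x => ?_⟩
  obtain ⟨f, hf, hfx⟩ := hL.2 (mapGeneric τ x)
  refine ⟨_, Submodule.mem_map_of_mem hf, fun h => hfx ?_⟩
  exact stalkPullback_injective τ x (h.trans (map_zero _).symm)

variable [hY : IsQuasiProjVariety Y] {n : ℕ} {L : Fin n → Submodule ℂ (RatFun Y)}

lemma zeroCounts_map_ratPullback (A : τ.source.toScheme.Opens) :
    zeroCounts (fun i => (L i).map (ratPullback τ hτ).toLinearMap) (τ.source.ι ''ᵁ A) =
      zeroCounts L (toHom τ ''ᵁ A) := by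
  have := jacobsonSpace_of_variety (X := X)
  have := jacobsonSpace_of_variety (X := Y)
  have h1 : ∀ f : Fin n → RatFun Y,
      zeros ((τ.source.ι ''ᵁ A : X.Opens) : Set X) (fun i => ratPullback τ hτ (f i)) =
        τ.source.ι '' zeros A fun i => openPullback (toHom τ) (f i) := by
    intro f
    simp only [← openPullback_ratPullback τ hτ]
    exact zeros_image (k := τ.source.ι) (A : Set τ.source.toScheme) _
  have h2 : ∀ f : Fin n → RatFun Y, zeros ((toHom τ ''ᵁ A : Y.Opens) : Set Y) f =
      toHom τ '' zeros A fun i => openPullback (toHom τ) (f i) :=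
    fun f => zeros_image (k := toHom τ) (A : Set τ.source.toScheme) f
  have hi1 := τ.source.ι.isOpenEmbedding.injective
  have hi2 := (toHom τ).isOpenEmbedding.injective
  ext m
  constructor
  · rintro ⟨f', hf', hfin, rfl⟩
    choose f hf hff' using hf'
    obtain rfl : (fun i => ratPullback τ hτ (f i)) = f' := funext hff'
    rw [h1] at hfin ⊢
    refine ⟨f, hf, ?_, ?_⟩
    · rw [h2]
      exact (hfin.of_finite_image hi1.injOn).image _
    · rw [h2, Set.ncard_image_of_injective _ hi1, Set.ncard_image_of_injective _ hi2]
  · rintro ⟨f, hf, hfin, rfl⟩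
    rw [h2] at hfin ⊢
    refine ⟨fun i => ratPullback τ hτ (f i), fun i => Submodule.mem_map_of_mem (hf i), ?_, ?_⟩
    · rw [h1]
      exact (hfin.of_finite_image hi2.injOn).image _
    · rw [h1, Set.ncard_image_of_injective _ hi1, Set.ncard_image_of_injective _ hi2]

lemma IsGood.map_ratPullback {A : τ.source.toScheme.Opens} (h : IsGood L (toHom τ ''ᵁ A)) :
    IsGood (fun i => (L i).map (ratPullback τ hτ).toLinearMap) (τ.source.ι ''ᵁ A) := by
  have := hX.isReduced
  refine ⟨dense_of_forall_genericPoint_mem fun x => ?_, ?_, ?_⟩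
  · obtain ⟨p, hp, hpx⟩ := genericPoint_mem_of_dense h.dense (mapGeneric τ x)
    have : p = srcPt τ x := (toHom τ).isOpenEmbedding.injective hpx
    exact ⟨p, hp, by rw [this]; rfl⟩
  · rintro i _ ⟨f, hf, rfl⟩
    refine exists_represents_of_forall_isRegularAt ?_
    rintro _ ⟨p, hp, rfl⟩
    obtain ⟨s, hs⟩ := h.regular i f hf
    have h1 := (isRegularAt_openPullback_iff (k := toHom τ) (f := f) (p := p)).mpr
      ⟨toHom τ ''ᵁ A, ⟨p, hp, rfl⟩, s, hs⟩
    rw [← openPullback_ratPullback τ hτ f] at h1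
    exact (isRegularAt_openPullback_iff (k := τ.source.ι) (p := p)).mp h1
  · rintro i _ ⟨p, hp, rfl⟩
    obtain ⟨f, hf, hfp⟩ := h.base i (toHom τ p) ⟨p, hp, rfl⟩
    refine ⟨_, Submodule.mem_map_of_mem hf, fun hv => hfp ?_⟩
    have h1 := (vanishesAt_openPullback_iff (k := τ.source.ι) (f := ratPullback τ hτ f)
      (p := p)).mpr hv
    rw [openPullback_ratPullback τ hτ f] at h1
    exact vanishesAt_openPullback_iff.mp h1

omit [X.Over SpecC] hX hY in
/-- Every good open subset of `Y` contains one in the range of the birational isomorphism. -/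
lemma IsGood.exists_image_toHom {U : Y.Opens} (h : IsGood L U) :
    ∃ A : τ.source.toScheme.Opens, IsGood L (toHom τ ''ᵁ A) := by
  have hopen : (toHom τ).opensRange = τ.target := by
    unfold toHom
    rw [Scheme.Hom.opensRange_comp_of_isIso, Scheme.Opens.opensRange_ι]
  have hrange : Set.range (toHom τ) = τ.target := congrArg (fun U : Y.Opens => (U : Set Y)) hopen
  have hle : toHom τ ''ᵁ toHom τ ⁻¹ᵁ U ≤ U := by
    rintro _ ⟨p, hp, rfl⟩
    exact hp
  refine ⟨toHom τ ⁻¹ᵁ U, h.mono hle ?_⟩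
  have : ((toHom τ ''ᵁ toHom τ ⁻¹ᵁ U : Y.Opens) : Set Y) = (U : Set Y) ∩ τ.target := by
    rw [← hrange]
    exact Set.image_preimage_eq_inter_range
  rw [this]
  exact h.dense.inter_of_isOpen_left τ.dense_target U.isOpen

end Birational

/-! ### Normality of smooth algebras and poles in codimension one -/

section Normal

open TensorProduct

lemma mem_nonZeroDivisors_of_flat {P S : Type} [CommRing P] [CommRing S] [Algebra P S]
    [Module.Flat P S] {p : P} (hp : p ∈ nonZeroDivisors P) :
    algebraMap P S p ∈ nonZeroDivisors S := by
  have h := Module.Flat.isSMulRegular_of_nonZeroDivisors (M := S) hp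
  refine mem_nonZeroDivisors_iff_right.mpr fun s hs => h ?_
  change p • s = p • 0
  rw [Algebra.smul_def, mul_comm, hs, smul_zero]

/-- An étale algebra over a normal domain is integrally closed in its total ring of fractions. -/
lemma isIntegrallyClosed_of_etale (P S : Type) [CommRing P] [CommRing S] [Algebra P S] [IsDomain P]
    [IsIntegrallyClosed P] [Algebra.Etale P S] : IsIntegrallyClosed S := by
  let K := FractionRing P
  let T := S ⊗[P] K
  have hfin : Module.Finite K (K ⊗[P] S) := Algebra.FormallyUnramified.finite_of_free _ _
  -- Every non-zero-divisor of `S` acts invertibly on the finite-dimensional `K`-algebra `T`.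
  have hunit : ∀ b ∈ nonZeroDivisors S, IsUnit (algebraMap S T b) := by
    intro b hb
    let b' : K ⊗[P] S := 1 ⊗ₜ b
    have hinj : Function.Injective (LinearMap.mulLeft K b') := by
      have h1 : Function.Injective (LinearMap.mulLeft P b) := fun x y h =>
        (mul_cancel_left_mem_nonZeroDivisors hb).mp h
      have h2 := Module.Flat.lTensor_preserves_injective_linearMap (M := K) _ h1
      have h3 : ∀ x, LinearMap.lTensor K (LinearMap.mulLeft P b) x = LinearMap.mulLeft K b' x := by
        intro x
        induction x with
        | zero => simp
        | add x y hx hy => rw [map_add, map_add, hx, hy]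
        | tmul k s => simp [b']
      intro x y hxy
      rw [← h3, ← h3] at hxy
      exact h2 hxy
    obtain ⟨y, hy⟩ := (LinearMap.injective_iff_surjective.mp hinj) 1
    have hb' : IsUnit b' := IsUnit.of_mul_eq_one y hy
    have := hb'.map (Algebra.TensorProduct.comm P K S)
    rw [Algebra.TensorProduct.comm_tmul] at this
    exact this
  have hfrac : IsFractionRing S T :=
    IsLocalization.of_le (Algebra.algebraMapSubmonoid S (nonZeroDivisors P)) (nonZeroDivisors S)
      (by
        rintro _ ⟨p, hp, rfl⟩
        exact mem_nonZeroDivisors_of_flat hp) hunit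
  refine (isIntegrallyClosed_iff T).mpr fun {x} hx => ?_
  obtain ⟨y, hy⟩ := (TensorProduct.toIntegralClosure_bijective_of_smooth
    (R := P) (S := S) (B := K)).2 ⟨x, hx⟩
  have hy' : Algebra.TensorProduct.map (.id S S) (integralClosure P K).val y = x :=
    congrArg Subtype.val hy
  rw [← hy']
  clear hy hy'
  induction y with
  | zero => exact ⟨0, by simp⟩
  | add y z hy hz =>
    obtain ⟨s, hs⟩ := hy
    obtain ⟨t, ht⟩ := hz
    exact ⟨s + t, by rw [map_add, map_add, hs, ht]⟩
  | tmul s k =>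
    obtain ⟨p, hp⟩ := IsIntegrallyClosed.isIntegral_iff.mp k.2
    refine ⟨p • s, ?_⟩
    have : (k : K) = p • (1 : K) := by rw [← hp, Algebra.algebraMap_eq_smul_one]
    rw [Algebra.TensorProduct.map_tmul, Subalgebra.coe_val, this, TensorProduct.tmul_smul,
      TensorProduct.smul_tmul']
    rfl

/-- If multiplication by the fraction `a / b` maps an ideal that contains the non-zero-divisor `b`
to itself, then `a / b` is integral by the Cayley–Hamilton theorem, hence an element of `S`. -/
lemma dvd_of_forall_mem_dvd {S : Type} [CommRing S] [IsNoetherianRing S] [IsIntegrallyClosed S]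
    {p : Ideal S} {a b : S} (hb : b ∈ nonZeroDivisors S) (hbp : b ∈ p)
    (h : ∀ s ∈ p, ∃ t ∈ p, s * a = b * t) : b ∣ a := by
  let T := FractionRing S
  let N : Submodule S T := Submodule.map (Algebra.linearMap S T) p
  let x : T := IsLocalization.mk' T a ⟨b, hb⟩
  have hbu : IsUnit (algebraMap S T b) := IsLocalization.map_units T (⟨b, hb⟩ : nonZeroDivisors S)
  have hx : algebraMap S T b * x = algebraMap S T a := IsLocalization.mk'_spec' T a ⟨b, hb⟩
  have hxN : ∀ y ∈ N, x * y ∈ N := by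
    rintro _ ⟨s, hs, rfl⟩
    obtain ⟨t, ht, hst⟩ := h s hs
    refine ⟨t, ht, hbu.mul_left_cancel ?_⟩
    change algebraMap S T b * algebraMap S T t = algebraMap S T b * (x * algebraMap S T s)
    rw [← mul_assoc, hx, ← map_mul, ← map_mul, ← hst, mul_comm]
  let e : Module.End S N := (LinearMap.mulLeft S x).restrict hxN
  have hN : Module.Finite S N := Module.Finite.iff_fg.mpr ((IsNoetherian.noetherian p).map _)
  obtain ⟨P, hP, hPe⟩ := LinearMap.exists_monic_and_aeval_eq_zero S e
  have key : ∀ (Q : Polynomial S) (y : N),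
      ((Polynomial.aeval e Q y : N) : T) = Polynomial.aeval x Q * y := by
    intro Q y
    induction Q using Polynomial.induction_on' with
    | add Q R hQ hR => simp [hQ, hR, add_mul]
    | monomial m r =>
      have : ∀ m, (((e ^ m) y : N) : T) = x ^ m * y := by
        intro m
        induction m with
        | zero => simp
        | succ m ih => rw [pow_succ', Module.End.mul_apply, pow_succ', mul_assoc, ← ih]; rfl
      simp [Polynomial.aeval_monomial, this, Algebra.smul_def, mul_assoc]
  have hint : IsIntegral S x := by
    refine ⟨P, hP, ?_⟩
    have h1 := key P ⟨algebraMap S T b, b, hbp, rfl⟩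
    rw [hPe] at h1
    exact hbu.mul_left_eq_zero.mp h1.symm
  obtain ⟨s, hs⟩ := (isIntegrallyClosed_iff T).mp inferInstance hint
  refine ⟨s, IsFractionRing.injective S T ?_⟩
  rw [map_mul, hs, hx]

/-- A fraction `a / b` over a normal ring that is not regular at a prime `q` is not regular at a
prime of height one contained in `q`. Such a prime is a minimal prime over the ideal of denominators
of `a / b`: it consists of the denominators of some fraction `a' / b`, which maps it to an ideal not
contained in it, and therefore it is minimal over a principal ideal. -/
lemma exists_height_eq_one_of_forall_dvd {S : Type} [CommRing S] [IsNoetherianRing S]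
    [IsIntegrallyClosed S] {a b : S} (hb : b ∈ nonZeroDivisors S) (q : Ideal S) [q.IsPrime]
    (hq : ∀ s, b ∣ s * a → s ∈ q) :
    ∃ p : Ideal S, p.IsPrime ∧ p ≤ q ∧ p.height = 1 ∧ ∀ s, b ∣ s * a → s ∈ p := by
  let M := S ⧸ Ideal.span {b}
  let N : Submodule S M := Submodule.span S {Submodule.Quotient.mk a}
  have hmk : ∀ s c : S, s • (Submodule.Quotient.mk c : M) = 0 ↔ b ∣ s * c := fun s c => by
    rw [← Submodule.Quotient.mk_smul, Submodule.Quotient.mk_eq_zero, smul_eq_mul,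
      Ideal.mem_span_singleton]
  have hann : ∀ s, s ∈ Module.annihilator S N ↔ b ∣ s * a := fun s => by
    rw [← hmk]
    exact Submodule.mem_annihilator_span_singleton _ _
  obtain ⟨p, hp, hpq⟩ := Ideal.exists_minimalPrimes_le (I := Module.annihilator S N) (J := q)
    fun s hs => hq s ((hann s).mp hs)
  have hpp : p.IsPrime := hp.1.1
  obtain ⟨-, ⟨x, hx⟩, hpx⟩ := isAssociatedPrime_iff.mp
    (Module.associatedPrimes.minimalPrimes_annihilator_subset_associatedPrimes S N hp)
  obtain ⟨a', rfl⟩ := Submodule.Quotient.mk_surjective _ x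
  have hmem : ∀ s, s ∈ p ↔ b ∣ s * a' := fun s => by
    rw [hpx, Submodule.mem_colon_singleton, ← hmk, Submodule.mem_bot, Subtype.ext_iff]
    rfl
  have hbp : b ∈ p := (hmem b).mpr (dvd_mul_right b a')
  obtain ⟨t, ht, u, hu, htu⟩ : ∃ t ∈ p, ∃ u ∉ p, t * a' = b * u := by
    by_contra! hcon
    have : b ∣ a' := dvd_of_forall_mem_dvd hb hbp fun s hs => by
      obtain ⟨t, ht⟩ := (hmem s).mp hs
      exact ⟨t, by_contra fun htp => hcon s hs t htp ht, ht⟩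
    exact hpp.one_notMem ((hmem 1).mpr (by rwa [one_mul]))
  refine ⟨p, hpp, hpq, le_antisymm ?_ ?_, fun s hs => hp.1.2 ((hann s).mpr hs)⟩
  · refine Ideal.height_le_one_of_isPrincipal_of_mem_minimalPrimes (Ideal.span {t}) p
      ⟨⟨hpp, (Ideal.span_singleton_le_iff_mem _).mpr ht⟩, ?_⟩
    rintro r ⟨hr, htr⟩ hrp y hy
    obtain ⟨w, hw⟩ := (hmem y).mp hy
    have h1 : u * y = t * w := by
      refine (mul_cancel_left_mem_nonZeroDivisors hb).mp ?_
      calc b * (u * y) = (b * u) * y := by ring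
        _ = t * (y * a') := by rw [← htu]; ring
        _ = b * (t * w) := by rw [hw]; ring
    have h2 : u * y ∈ r := by
      rw [h1]
      exact r.mul_mem_right _ ((Ideal.span_singleton_le_iff_mem _).mp htr)
    exact (hr.mem_or_mem h2).resolve_left fun h => hu (hrp h)
  · rw [Order.one_le_iff_pos, pos_iff_ne_zero]
    intro h0
    exact Set.disjoint_left.mp (Ideal.disjoint_nonZeroDivisors_of_mem_minimalPrimes
      (Ideal.height_eq_zero_iff.mp h0)) hbp hb

end Normal

section Poles

variable {X : Scheme.{0}}

lemma primeIdealOf_fromSpec {V : X.Opens} (hV : IsAffineOpen V) (y : PrimeSpectrum Γ(X, V))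
    (h : hV.fromSpec y ∈ V) : hV.primeIdealOf ⟨hV.fromSpec y, h⟩ = y :=
  hV.fromSpec.isOpenEmbedding.injective (hV.fromSpec_primeIdealOf ⟨hV.fromSpec y, h⟩)

lemma ringKrullDim_stalk_fromSpec {V : X.Opens} (hV : IsAffineOpen V)
    (y : PrimeSpectrum Γ(X, V)) :
    ringKrullDim (X.presheaf.stalk (hV.fromSpec y)) = y.asIdeal.height := by
  have hy := fromSpec_mem hV y
  let := TopCat.Presheaf.algebra_section_stalk X.presheaf ⟨hV.fromSpec y, hy⟩
  have := hV.isLocalization_stalk ⟨hV.fromSpec y, hy⟩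
  rw [IsLocalization.AtPrime.ringKrullDim_eq_height
    (hV.primeIdealOf ⟨hV.fromSpec y, hy⟩).asIdeal, primeIdealOf_fromSpec]

lemma mem_basicOpen_genericPoint {V : X.Opens} (hV : IsAffineOpen V) {b : Γ(X, V)}
    (hb : b ∈ nonZeroDivisors Γ(X, V)) (η : genericPoints X) (hη : η.1 ∈ V) :
    η.1 ∈ X.basicOpen b := by
  obtain ⟨y, hy⟩ := exists_fromSpec_eq hV hη
  have h1 : y.asIdeal ∈ minimalPrimes Γ(X, V) :=
    (fromSpec_mem_genericPoints_iff hV y).mp (hy ▸ η.2)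
  rw [← hy, fromSpec_mem_basicOpen]
  exact fun h => Set.disjoint_left.mp (Ideal.disjoint_nonZeroDivisors_of_mem_minimalPrimes h1) h hb

variable [IsReduced X]

lemma section_ext_genericPoints {V : X.Opens} {s t : Γ(X, V)}
    (h : ∀ (η : genericPoints X) (hη : η.1 ∈ V),
      X.presheaf.germ V η.1 hη s = X.presheaf.germ V η.1 hη t) : s = t := by
  rw [← sub_eq_zero]
  refine eq_zero_of_represents_zero fun η hη => ?_
  rw [map_sub, h η hη, sub_self]
  rfl

/-- On an affine open set every rational function is a quotient of regular functions. -/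
lemma exists_germ_eq_germ_mul [IsNoetherian X] {V : X.Opens} (hV : IsAffineOpen V)
    (f : RatFun X) : ∃ (a b : Γ(X, V)), b ∈ nonZeroDivisors Γ(X, V) ∧
      ∀ (η : genericPoints X) (hη : η.1 ∈ V),
        X.presheaf.germ V η.1 hη a = X.presheaf.germ V η.1 hη b * f η := by
  have hN : IsNoetherianRing Γ(X, V) := IsLocallyNoetherian.component_noetherian ⟨V, hV⟩
  let R : Set X := {x | IsRegularAt f x}
  have hR : IsOpen R := isOpen_iff_forall_mem_open.mpr fun x ⟨U, hx, s, hs⟩ =>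
    ⟨U, fun y hy => ⟨U, hy, s, hs⟩, U.isOpen, hx⟩
  obtain ⟨I, hI⟩ := (PrimeSpectrum.isClosed_iff_zeroLocus_ideal (R := Γ(X, V)) _).mp
    (hR.preimage hV.fromSpec.continuous).isClosed_compl
  have hI' : ∀ y : PrimeSpectrum Γ(X, V), I ≤ y.asIdeal ↔ ¬ IsRegularAt f (hV.fromSpec y) := by
    intro y
    have : y ∈ (hV.fromSpec ⁻¹' R)ᶜ ↔ I ≤ y.asIdeal := by rw [hI]; rfl
    rw [← this]
    rfl
  -- By prime avoidance `I` contains a non-zero-divisor.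
  obtain ⟨s, hsI, hs⟩ : ∃ s ∈ I, ∀ p ∈ minimalPrimes Γ(X, V), s ∉ p := by
    by_contra! hcon
    have hfin := minimalPrimes.finite_of_isNoetherianRing Γ(X, V)
    have h1 : (I : Set Γ(X, V)) ⊆ ⋃ p ∈ (hfin.toFinset : Set (Ideal Γ(X, V))), (p : Set Γ(X, V)) := by
      intro s hs
      obtain ⟨p, hp, hsp⟩ := hcon s hs
      exact Set.mem_biUnion (by simpa using hp) hsp
    obtain ⟨p, hp, hIp⟩ := (Ideal.subset_union_prime ⊥ ⊥ fun p hp _ _ =>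
      (hfin.mem_toFinset.mp hp).1.1).mp h1
    rw [hfin.mem_toFinset] at hp
    refine (hI' ⟨p, hp.1.1⟩).mp hIp ?_
    obtain ⟨W, hW, s, hs⟩ := exists_represents_genericPoint f
      ⟨_, (fromSpec_mem_genericPoints_iff hV ⟨p, hp.1.1⟩).mpr hp⟩
    exact ⟨W, hW, s, hs⟩
  have hsV : ∀ (η : genericPoints X), η.1 ∈ V → η.1 ∈ X.basicOpen s := by
    intro η hη
    obtain ⟨y, hy⟩ := exists_fromSpec_eq hV hη
    rw [← hy, fromSpec_mem_basicOpen]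
    exact hs _ ((fromSpec_mem_genericPoints_iff hV y).mp (hy ▸ η.2))
  obtain ⟨t, ht⟩ : ∃ t : Γ(X, X.basicOpen s), Represents t f := by
    refine exists_represents_of_forall_isRegularAt fun x hx => ?_
    obtain ⟨y, rfl⟩ := exists_fromSpec_eq hV (X.basicOpen_le s hx)
    rw [fromSpec_mem_basicOpen] at hx
    by_contra hcon
    exact hx ((hI' y).mpr hcon hsI)
  have := hV.isLocalization_basicOpen s
  obtain ⟨⟨a, ⟨_, k, rfl⟩⟩, hab⟩ := IsLocalization.surj (Submonoid.powers s) t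
  have hgerm : ∀ (η : genericPoints X) (hη : η.1 ∈ V),
      X.presheaf.germ V η.1 hη a = X.presheaf.germ V η.1 hη (s ^ k) * f η := by
    intro η hη
    have h1 := congrArg (X.presheaf.germ _ η.1 (hsV η hη)) hab
    rw [map_mul, ht η (hsV η hη)] at h1
    have h2 : ∀ c : Γ(X, V), X.presheaf.germ _ η.1 (hsV η hη)
        (algebraMap Γ(X, V) Γ(X, X.basicOpen s) c) = X.presheaf.germ V η.1 hη c := fun c =>
      X.presheaf.germ_res_apply _ _ _ c
    rw [h2, h2] at h1
    rw [← h1, mul_comm]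
  refine ⟨a, s ^ k, pow_mem (mem_nonZeroDivisors_iff_right.mpr fun c hc => ?_) k, hgerm⟩
  refine section_ext_genericPoints fun η hη => ?_
  have h1 := congrArg (X.presheaf.germ V η.1 hη) hc
  rw [map_mul, map_zero] at h1
  rw [map_zero]
  exact ((X.mem_basicOpen s η.1 hη).mp (hsV η hη)).mul_left_eq_zero.mp h1

/-- Regularity of a quotient at a point, in terms of the ideal of denominators. -/
lemma isRegularAt_fromSpec_iff {V : X.Opens} (hV : IsAffineOpen V) {f : RatFun X}
    {a b : Γ(X, V)} (hb : b ∈ nonZeroDivisors Γ(X, V))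
    (hab : ∀ (η : genericPoints X) (hη : η.1 ∈ V),
      X.presheaf.germ V η.1 hη a = X.presheaf.germ V η.1 hη b * f η)
    (y : PrimeSpectrum Γ(X, V)) :
    IsRegularAt f (hV.fromSpec y) ↔ ∃ r ∉ y.asIdeal, b ∣ r * a := by
  have hbη : ∀ (η : genericPoints X) (hη : η.1 ∈ V), IsUnit (X.presheaf.germ V η.1 hη b) :=
    fun η hη => (X.mem_basicOpen b η.1 hη).mp (mem_basicOpen_genericPoint hV hb η hη)
  constructor
  · rintro ⟨U, hyU, s, hs⟩
    obtain ⟨r, hrU, hyr⟩ := hV.exists_basicOpen_le ⟨hV.fromSpec y, hyU⟩ (fromSpec_mem hV y)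
    have ht := hs.res (homOfLE hrU)
    have := hV.isLocalization_basicOpen r
    obtain ⟨⟨c, ⟨_, k, rfl⟩⟩, hc⟩ := IsLocalization.surj (Submonoid.powers r)
      (X.presheaf.map (homOfLE hrU).op s)
    refine ⟨r ^ (k + 1), fun h => (fromSpec_mem_basicOpen hV y r).mp hyr
      (y.2.mem_of_pow_mem _ h), r * c, section_ext_genericPoints fun η hη => ?_⟩
    by_cases hηr : η.1 ∈ X.basicOpen r
    · have h1 := congrArg (X.presheaf.germ _ η.1 hηr) hc
      rw [map_mul, ht η hηr] at h1
      have h2 : ∀ c : Γ(X, V), X.presheaf.germ _ η.1 hηr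
          (algebraMap Γ(X, V) Γ(X, X.basicOpen r) c) = X.presheaf.germ V η.1 hη c := fun c =>
        X.presheaf.germ_res_apply _ _ _ c
      rw [h2, h2] at h1
      simp only [map_mul, pow_succ, ← h1, hab η hη]
      ring
    · have h0 : X.presheaf.germ V η.1 hη r = 0 := by
        by_contra h0
        let := (isField_stalk_of_closure_mem_irreducibleComponents X η.1 η.2).toField
        exact hηr ((X.mem_basicOpen r η.1 hη).mpr (IsUnit.mk0 _ h0))
      simp only [map_mul, pow_succ, h0]
      ring
  · rintro ⟨r, hr, c, hc⟩
    have hru : IsUnit (X.presheaf.map (homOfLE (X.basicOpen_le r)).op r) :=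
      RingedSpace.isUnit_res_basicOpen X.toRingedSpace r
    obtain ⟨r', hr'⟩ := hru.exists_right_inv
    refine ⟨X.basicOpen r, (fromSpec_mem_basicOpen hV y r).mpr hr,
      r' * X.presheaf.map (homOfLE (X.basicOpen_le r)).op c, fun η hη => ?_⟩
    have hηV : η.1 ∈ V := X.basicOpen_le r hη
    have h1 := congrArg (X.presheaf.germ V η.1 hηV) hc
    rw [map_mul, map_mul, hab η hηV, mul_left_comm] at h1
    have h2 := (hbη η hηV).mul_left_cancel h1
    have h3 := congrArg (X.presheaf.germ _ η.1 hη) hr'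
    have h4 : ∀ c : Γ(X, V), X.presheaf.germ _ η.1 hη
        (X.presheaf.map (homOfLE (X.basicOpen_le r)).op c) = X.presheaf.germ V η.1 hηV c := fun c =>
      X.presheaf.germ_res_apply _ _ _ c
    rw [map_mul, map_one, h4] at h3
    rw [map_mul, h4, ← h2, ← mul_assoc, mul_comm _ (X.presheaf.germ V η.1 hηV r), h3, one_mul]

/-- On a normal affine open set a rational function that is not regular at a point `z` has a
pole along a divisor through `z`. -/
lemma exists_hasPoleAlong_of_isIntegrallyClosed [IsNoetherian X] {V : X.Opens}
    (hV : IsAffineOpen V) [IsIntegrallyClosed Γ(X, V)] {f : RatFun X} {z : X} (hz : z ∈ V)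
    (hf : ¬ IsRegularAt f z) : ∃ D : Set X, HasPoleAlong f D ∧ z ∈ D := by
  have hN : IsNoetherianRing Γ(X, V) := IsLocallyNoetherian.component_noetherian ⟨V, hV⟩
  obtain ⟨a, b, hb, hab⟩ := exists_germ_eq_germ_mul hV f
  obtain ⟨y, rfl⟩ := exists_fromSpec_eq hV hz
  rw [isRegularAt_fromSpec_iff hV hb hab] at hf
  push Not at hf
  obtain ⟨p, hp, hpy, hht, hpJ⟩ := exists_height_eq_one_of_forall_dvd (a := a) hb y.asIdeal
    fun s hs => by_contra fun h => hf s h hs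
  refine ⟨closure {hV.fromSpec ⟨p, hp⟩}, ⟨isIrreducible_singleton.closure, isClosed_closure,
    hV.fromSpec ⟨p, hp⟩, rfl, ?_, ?_⟩, ?_⟩
  · rw [ringKrullDim_stalk_fromSpec, hht]
    rfl
  · rw [isRegularAt_fromSpec_iff hV hb hab]
    rintro ⟨r, hr, hr'⟩
    exact hr (hpJ r hr')
  · have h1 : (⟨p, hp⟩ : PrimeSpectrum Γ(X, V)) ⤳ y := (PrimeSpectrum.le_iff_specializes _ _).mp hpy
    exact specializes_iff_mem_closure.mp (h1.map hV.fromSpec.continuous)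

omit [IsReduced X] in
/-- Smooth points have normal affine neighbourhoods. -/
lemma IsSmoothPoint.exists_isIntegrallyClosed [X.Over SpecC] {z : X} (hz : IsSmoothPoint z) :
    ∃ V : X.Opens, IsAffineOpen V ∧ z ∈ V ∧ IsIntegrallyClosed Γ(X, V) := by
  obtain ⟨U, hzU, hU⟩ := hz
  obtain ⟨U₀, -, V, hV, hzV, e, he⟩ := Smooth.exists_isStandardSmooth (U.ι ≫ X ↘ SpecC) ⟨z, hzU⟩
  obtain ⟨m, g, -, hg⟩ := he.exists_etale_mvPolynomial
  have hU₀ : U₀ = ⊤ := by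
    refine top_le_iff.mp fun x _ => ?_
    have : x = (U.ι ≫ X ↘ SpecC) ⟨z, hzU⟩ :=
      Subsingleton.elim (α := PrimeSpectrum ℂ) _ _
    rw [this]
    exact e hzV
  subst hU₀
  let ε : MvPolynomial (Fin m) ℂ ≃+* MvPolynomial (Fin m) Γ(SpecC, ⊤) :=
    MvPolynomial.mapEquiv _
      (Scheme.ΓSpecIso (CommRingCat.of ℂ)).symm.commRingCatIsoToRingEquiv
  have : IsDomain (MvPolynomial (Fin m) Γ(SpecC, ⊤)) := ε.symm.toMulEquiv.isDomain _
  have : IsIntegrallyClosed (MvPolynomial (Fin m) Γ(SpecC, ⊤)) := IsIntegrallyClosed.of_equiv ε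
  algebraize [g]
  have := isIntegrallyClosed_of_etale (MvPolynomial (Fin m) Γ(SpecC, ⊤)) Γ(U.toScheme, V)
  exact ⟨U.ι ''ᵁ V, hV.image_of_isOpenImmersion U.ι, ⟨⟨z, hzU⟩, hzV, rfl⟩,
    IsIntegrallyClosed.of_equiv (U.ι.appIso V).symm.commRingCatIsoToRingEquiv⟩

end Poles

/-! ### Admissible subvarieties -/

/-- A closed subset of a variety of pure dimension `n` that contains no component has dimension
less than `n`. -/
lemma topologicalKrullDim_lt_of_forall_genericPoint_notMem {X : Scheme.{0}} {n : ℕ}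
    (hX : IsPureDim X n) {S : Set X} (hS : IsClosed S)
    (h : ∀ η : genericPoints X, η.1 ∉ S) : topologicalKrullDim S < n := by
  have hsober : QuasiSober S := hS.isClosedEmbedding_subtypeVal.quasiSober
  have key : ∀ p : LTSeries (IrreducibleCloseds S), p.length + 1 ≤ n := by
    intro p
    -- The generic points of a chain in `S`, together with the generic point of a component of `X`
    -- through them, give a longer chain in that component.
    choose x hx using fun i => QuasiSober.sober (p i).2 (p i).3
    have hspec : ∀ i j, i < j → x j ⤳ x i ∧ ¬ x i ⤳ x j := by
      intro i j hij
      have h1 : p i < p j := p.strictMono hij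
      simp only [specializes_iff_closure_subset, (hx i).def, (hx j).def]
      exact ⟨h1.le, h1.not_ge⟩
    obtain ⟨η, hη⟩ := exists_genericPoint_specializes (x (Fin.last p.length)).1
    let Z : Set X := closure {η.1}
    have hxη : ∀ i, η.1 ⤳ (x i).1 := by
      intro i
      rcases (Fin.le_last i).eq_or_lt with rfl | hi
      · exact hη
      · exact hη.trans ((hspec i _ hi).1.map continuous_subtype_val)
    let cl : Z → IrreducibleCloseds Z := fun z =>
      ⟨closure {z}, isIrreducible_singleton.closure, isClosed_closure⟩
    have hcl : ∀ z w : Z, w.1 ⤳ z.1 → ¬ z.1 ⤳ w.1 → cl z < cl w := by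
      intro z w h1 h2
      refine lt_of_le_not_ge ?_ fun hle => h2 ?_
      · exact specializes_iff_closure_subset.mp (Topology.IsInducing.subtypeVal.specializes_iff.mp h1)
      · exact Topology.IsInducing.subtypeVal.specializes_iff.mpr
          (specializes_iff_closure_subset.mpr hle)
    let q : LTSeries (IrreducibleCloseds Z) :=
      { length := p.length
        toFun := fun i => cl ⟨(x i).1, specializes_iff_mem_closure.mp (hxη i)⟩
        step := fun i => by
          have h1 := hspec i.castSucc i.succ i.castSucc_lt_succ
          exact hcl _ _ (h1.1.map continuous_subtype_val)
            fun h2 => h1.2 (Topology.IsInducing.subtypeVal.specializes_iff.mp h2) }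
    let r := q.snoc (cl ⟨η.1, subset_closure rfl⟩) (hcl _ _ (hxη _) fun h1 => by
      have h2 := eq_of_specializes_genericPoint η h1
      exact h η (h2 ▸ (x (Fin.last p.length)).2))
    have h1 : (r.length : WithBot ℕ∞) ≤ topologicalKrullDim Z := Order.LTSeries.length_le_krullDim r
    rw [hX Z η.2] at h1
    have h2 : r.length = p.length + 1 := rfl
    rw [h2] at h1
    exact_mod_cast h1
  rcases isEmpty_or_nonempty (IrreducibleCloseds S) with he | ⟨⟨c⟩⟩
  · rw [topologicalKrullDim, Order.krullDim_eq_bot]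
    exact WithBot.bot_lt_coe _
  · obtain ⟨k, rfl⟩ := Nat.exists_eq_add_of_le' (key (RelSeries.singleton _ c))
    have h1 : topologicalKrullDim S ≤ (k : WithBot ℕ∞) := iSup_le fun p => by
      have := key p
      exact_mod_cast (by simpa using this : p.length ≤ k)
    refine h1.trans_lt ?_
    exact_mod_cast Nat.lt_succ_self k

section Admissible

variable {X : Scheme.{0}} [X.Over SpecC] [hX : IsQuasiProjVariety X] {n : ℕ}
  {L : Fin n → Submodule ℂ (RatFun X)}

include hX in
/-- The complement of an admissible subvariety is good: by normality, a function that is not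
regular at a smooth point has a pole along a divisor through that point. -/
lemma IsAdmissible.isGood (hdim : IsPureDim X n) {S : Closeds X} (hS : IsAdmissible L S) :
    IsGood L S.compl := by
  have := hX.isReduced
  have := isNoetherian_of_variety (X := X)
  refine ⟨dense_of_forall_genericPoint_mem fun η hη => ?_, fun i f hf => ?_, fun i x hx => ?_⟩
  · have h1 : closure {η.1} ⊆ (S : Set X) :=
      closure_minimal (Set.singleton_subset_iff.mpr hη) S.isClosed
    have h2 : topologicalKrullDim (closure {η.1} : Set X) ≤ topologicalKrullDim (S : Set X) :=
      (Topology.IsEmbedding.inclusion h1).isInducing.topologicalKrullDim_le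
    rw [hdim _ η.2] at h2
    exact (hS.dim_lt.trans_le h2).false
  · refine exists_represents_of_forall_isRegularAt fun x hx => ?_
    by_contra hreg
    obtain ⟨V, hV, hxV, hVn⟩ := (not_not.mp (mt (hS.singular x) hx)).exists_isIntegrallyClosed
    obtain ⟨D, hD, hxD⟩ := exists_hasPoleAlong_of_isIntegrallyClosed hV hxV hreg
    exact hx (hS.poles i f hf D hD hxD)
  · by_contra! hcon
    exact hx (hS.baseLocus i x hcon)

include hX in
/-- The complement of the open set of smooth points at which all functions of the `Lᵢ` are regular
and every `Lᵢ` contains a non-vanishing function is admissible. -/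
lemma exists_isAdmissible (hdim : IsPureDim X n) (hL : ∀ i, L i ∈ Krat X) :
    ∃ S : Closeds X, IsAdmissible L S := by
  have := hX.isReduced
  have := hX.locallyOfFiniteType
  have := isNoetherian_of_variety (X := X)
  obtain ⟨ι, _, g, hg⟩ := exists_generators L fun i => (hL i).1
  let reg : RatFun X → X.Opens := fun f => ⟨{x | IsRegularAt f x},
    isOpen_iff_forall_mem_open.mpr fun x ⟨U, hx, s, hs⟩ =>
      ⟨U, fun y hy => ⟨U, hy, s, hs⟩, U.isOpen, hx⟩⟩
  let nonvan : RatFun X → X.Opens := fun f =>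
    ⟨{x | ∃ (U : X.Opens) (s : Γ(X, U)), Represents s f ∧ x ∈ X.basicOpen s},
      isOpen_iff_forall_mem_open.mpr fun x ⟨U, s, hs, hx⟩ =>
        ⟨X.basicOpen s, fun y hy => ⟨U, s, hs, hy⟩, (X.basicOpen s).isOpen, hx⟩⟩
  have hnonvan : ∀ f x, x ∈ nonvan f → ¬ VanishesAt f x := by
    rintro f x ⟨U, s, hs, hx⟩ hv
    exact (hs.vanishesAt_iff (X.basicOpen_le s hx)).mp hv hx
  let sm : X.Opens := ⟨{x | IsSmoothPoint x}, isOpen_iff_forall_mem_open.mpr fun x ⟨U, hx, hU⟩ =>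
    ⟨U, fun y hy => ⟨U, hy, hU⟩, U.isOpen, hx⟩⟩
  let O : X.Opens := sm ⊓ (Finset.univ.inf fun p : Fin n × ι => reg (g p.1 p.2)) ⊓
    Finset.univ.inf fun i => ⨆ f : L i, nonvan f.1
  have hO : ∀ x, x ∈ O ↔ (IsSmoothPoint x ∧ ∀ i j, IsRegularAt (g i j) x) ∧
      ∀ i, ∃ f ∈ L i, x ∈ nonvan f := by
    intro x
    change (x ∈ sm ∧ x ∈ ((Finset.univ.inf fun p : Fin n × ι => reg (g p.1 p.2) : X.Opens) : Set X))
      ∧ x ∈ ((Finset.univ.inf fun i => ⨆ f : L i, nonvan f.1 : X.Opens) : Set X) ↔ _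
    simp only [Opens.coe_finset_inf]
    simp [sm, reg]
  -- All generic points lie in `O`.
  have hgen : ∀ η : genericPoints X, η.1 ∈ O := by
    intro η
    refine (hO _).mpr ⟨⟨?_, fun i j => ?_⟩, fun i => ?_⟩
    · have : LocallyOfFinitePresentation (X ↘ SpecC) := inferInstance
      have h1 := genericPoint_mem_of_dense
        (Scheme.Hom.dense_smoothLocus_of_perfectField (K := ℂ) (X ↘ SpecC)) η
      refine ⟨(X ↘ SpecC).smoothLocus, h1, ?_⟩
      rw [← Scheme.Hom.smoothLocus_eq_top_iff, ← Scheme.Hom.preimage_smoothLocus_eq]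
      exact Opens.ext (by ext y; simp)
    · obtain ⟨V, hV, s, hs⟩ := exists_represents_genericPoint (g i j) η
      exact ⟨V, hV, s, hs⟩
    · obtain ⟨f, hf, hf0⟩ := (hL i).2 η
      obtain ⟨V, hV, s, hs⟩ := exists_represents_genericPoint f η
      refine ⟨f, hf, V, s, hs, by_contra fun hη => hf0 ?_⟩
      exact VanishesAt.genericPoint_eq_zero ⟨V, hV, s, hs, hη⟩
  refine ⟨O.compl, fun x hx hxO => hx ((hO x).mp hxO).1.1,
    topologicalKrullDim_lt_of_forall_genericPoint_notMem hdim O.compl.isClosed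
      fun η hη => hη (hgen η), fun i f hf D hD => ?_, fun i x hx hxO => ?_⟩
  · obtain ⟨-, -, z, hz, -, hzf⟩ := hD
    rw [← hz.def]
    refine closure_minimal (Set.singleton_subset_iff.mpr fun hzO => hzf ?_) O.compl.isClosed
    have hzO := ((hO z).mp hzO).1.2 i
    rw [← hg i] at hf
    obtain ⟨d, rfl⟩ := (Submodule.mem_span_range_iff_exists_fun ℂ).mp hf
    choose U hU s hs using hzO
    let W : X.Opens := Finset.univ.inf U
    have hzW : z ∈ ((Finset.univ.inf U : X.Opens) : Set X) := by
      rw [Opens.coe_finset_inf]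
      simpa using hU
    exact ⟨W, hzW, _, Represents.sum Finset.univ fun j =>
      ((hs j).res (homOfLE (Finset.inf_le (Finset.mem_univ j) : W ≤ U j))).smul (d j)⟩
  · obtain ⟨f, hf, hfx⟩ := ((hO x).mp hxO).2 i
    exact hnonvan f x hfx (hx f hf)

include hX in
lemma IsGood.restrict_mem_Kreg (hL : ∀ i, L i ∈ Krat X) {U : X.Opens} (hU : IsGood L U)
    (i : Fin n) : restrict (L i) U ∈ Kreg U := by
  have := hX.isReduced
  refine ⟨?_, fun x hx => ?_⟩
  · obtain ⟨ι, _, g, hg⟩ := exists_generators L fun i => (hL i).1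
    obtain ⟨s, hs⟩ := hU.exists_represents hg
    have hle : restrict (L i) U ≤ Submodule.span ℂ (Set.range (s i)) := by
      rintro t ⟨f, hf, ht⟩
      rw [← hg i] at hf
      obtain ⟨d, rfl⟩ := (Submodule.mem_span_range_iff_exists_fun ℂ).mp hf
      rw [ht.unique (Represents.sum Finset.univ fun j => (hs i j).smul (d j))]
      exact Submodule.sum_mem _ fun j _ =>
        Submodule.smul_mem _ _ (Submodule.subset_span (Set.mem_range_self j))
    have : FiniteDimensional ℂ (Submodule.span ℂ (Set.range (s i))) :=
      FiniteDimensional.span_of_finite ℂ (Set.finite_range (s i))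
    exact Submodule.finiteDimensional_of_le hle
  · obtain ⟨f, hf, hfx⟩ := hU.base i x hx
    obtain ⟨s, hs⟩ := hU.regular i f hf
    exact ⟨s, ⟨f, hf, hs⟩, not_not.mp (mt (hs.vanishesAt_iff hx).mpr hfx)⟩

include hX in
lemma IsAdmissible.indexOff_eq (hdim : IsPureDim X n) {S : Closeds X} (hS : IsAdmissible L S) :
    indexOff L S = sSup (zeroCounts L S.compl) := by
  rw [indexOff, regIndex, (hS.isGood hdim).rootCounts_eq]

include hX in
/-- The intersection index may be computed on any good open set. -/
lemma IsGood.interIndex_eq (hdim : IsPureDim X n) (hL : ∀ i, L i ∈ Krat X) {U : X.Opens}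
    (hU : IsGood L U) : interIndex L = sSup (zeroCounts L U) := by
  have h := exists_isAdmissible hdim hL
  rw [interIndex, dif_pos h, h.choose_spec.indexOff_eq hdim]
  exact (h.choose_spec.isGood hdim).sSup_zeroCounts_eq hdim (fun i => (hL i).1) hU

end Admissible

end RatIndex

theorem mainTheorem11 (n : ℕ) (X Y : Scheme.{0}) [X.Over SpecC] [Y.Over SpecC]
    [IsQuasiProjVariety X] [IsQuasiProjVariety Y] (hX : IsPureDim X n) (hY : IsPureDim Y n) :
    (∀ L : Fin n → Submodule ℂ (RatFun X), (∀ i, L i ∈ Krat X) →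
      (∃ S : Closeds X, IsAdmissible L S) ∧
      ∀ S : Closeds X, IsAdmissible L S →
        (∀ i, ∀ f ∈ L i, ∃ s : Γ(X, S.compl), Represents s f) ∧
        (∀ i, restrict (L i) S.compl ∈ Kreg S.compl) ∧
        IsGreatest (rootCounts S.compl fun i => restrict (L i) S.compl) (indexOff L S) ∧
        indexOff L S = interIndex L) ∧
    (∀ (τ : X.PartialIso Y) (hτ : τ.IsOver (X ↘ SpecC) (Y ↘ SpecC))
      (L : Fin n → Submodule ℂ (RatFun Y)), (∀ i, L i ∈ Krat Y) →
        (∀ i, (L i).map (ratPullback τ hτ).toLinearMap ∈ Krat X) ∧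
        interIndex L = interIndex fun i => (L i).map (ratPullback τ hτ).toLinearMap) := by
  refine ⟨fun L hL => ⟨exists_isAdmissible hX hL, fun S hS => ?_⟩, fun τ hτ L hL => ?_⟩
  · have hgood := hS.isGood hX
    refine ⟨hgood.regular, hgood.restrict_mem_Kreg hL, ?_, ?_⟩
    · obtain ⟨m, hm, -⟩ := hgood.exists_isGreatest hX fun i => (hL i).1
      rw [hgood.rootCounts_eq, hS.indexOff_eq hX, hm.csSup_eq]
      exact hm
    · rw [hS.indexOff_eq hX, hgood.interIndex_eq hX hL]
  · have hL' : ∀ i, (L i).map (ratPullback τ hτ).toLinearMap ∈ Krat X :=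
      fun i => map_ratPullback_mem_Krat τ hτ (hL i)
    obtain ⟨S, hS⟩ := exists_isAdmissible hY hL
    obtain ⟨A, hA⟩ := (hS.isGood hY).exists_image_toHom τ
    refine ⟨hL', ?_⟩
    rw [hA.interIndex_eq hY hL, (hA.map_ratPullback τ hτ).interIndex_eq hX hL',
      zeroCounts_map_ratPullback]
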